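/- \textbf{Model.} Algorithms run on a real RAM: memory cells holding natural numbers (with addition, truncated subtraction and comparison) or real numbers (with $+,-,\times,/$, $\sqrt{\cdot}$, $\exp$ and comparison), with conversion of naturals to reals, indirect addressing, and unit cost per operation; a single program must work for all inputs. \textbf{Input.} Integers $n\ge 2$ and $d\ge 0$, an error parameter $\varepsilon\in(0,1]$, and non-empty finite point sets $\mathcal P_1,\dots,\mathcal P_n\subset\mathbb R^d$, stored sparsely: for each distinct point, the list of its nonzero coordinates (index and value). Put $\Omega_i=\operatorname{conv}(\mathcal P_i)$ and assume $\bigcap_{i=1}^n\Omega_i=\varnothing$. \textbf{Notation.} Let $N$ be the total number of nonzero coordinates of all points in $\mathcal P_1,\dots,\mathcal P_n$. A closed ball $B(z,r)$, $r\ge 0$, is an \emph{intersecting ball} if $B(z,r)\cap\Omega_i\ne\varnothing$ for all $i$. Let $r^*$ be the smallest radius of an intersecting ball (a smallest intersecting ball, SIB, is one of radius $r^*$), let $D$ be the diameter of $\operatorname{conv}(\Omega_1\cup\dots\cup\Omega_n)$, and let $R=D/r^*$. A $(1+\varepsilon)$-approximate SIB is an intersecting ball $B(z,r)$ with $r\le(1+\varepsilon)r^*$.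 \textbf{Statement.} There are a single algorithm and an absolute constant $C$ such that, on every such input, the algorithm computes a $(1+\varepsilon)$-approximate SIB of $\Omega_1,\dots,\Omega_n$ in at most $$C\cdot\frac{R^2\,(N+nd)\,\log n}{\varepsilon^2}$$ steps. Moreover, for the same algorithm and constant: (a) (smallest enclosing ball) if every $\mathcal P_i=\{c_i\}$ is a singleton, then the computed ball contains all $c_i$, its radius is at most $(1+\varepsilon)$ times the least radius of a ball containing all $c_i$, and the number of steps is at most $C\,nd\log n/\varepsilon^2$; (b) (polytope distance) if $n=2$ and $\delta$ is the distance between $\Omega_1$ and $\Omega_2$, then the computed radius $r$ satisfies $\delta\le 2r\le(1+\varepsilon)\delta$, and the number of steps is at most $C\,R^2(N+d)/\varepsilon^2$; (c) (intersection radius of line segments) if $\mathcal P_i=\{a_i,b_i\}$ for all $i$, so that $\Omega_i$ is the segment $[a_i,b_i]$, then the computed ball is a $(1+\varepsilon)$-approximate SIB of these segments, and the number of steps is at most $C\,R^2\,nd\log n/\varepsilon^2$. -/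

import Mathlib

open Set

/-!  A real RAM, written as a small imperative language with a step count.

The memory consists of natural-number cells (used for indices and counters) and real cells.
Cells are grouped in scalar variables and in unbounded arrays; a fixed program mentions finitely
many variables and arrays, but may address array cells indirectly. Naturals can be added,
subtracted (truncated) and compared, but not multiplied; reals can be added, subtracted, multiplied,
divided, compared, and `sqrt` and `exp` are available. There is no rounding of reals to naturals.
Every operation costs one step. -/

namespace RealRAM

/-- The contents of the memory. -/
structure Store where
  /-- natural-number variables -/
  nvar : ℕ → ℕ
  /-- real variables -/
  rvar : ℕ → ℝ
  /-- natural-number arrays: `narr a i` is cell `i` of array `a` -/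
  narr : ℕ → ℕ → ℕ
  /-- real arrays: `rarr a i` is cell `i` of array `a` -/
  rarr : ℕ → ℕ → ℝ

/-- Natural-number expressions. -/
inductive NExp where
  | const (k : ℕ)
  | var (x : ℕ)
  | get (a : ℕ) (i : NExp)
  | add (e f : NExp)
  | sub (e f : NExp)

/-- Real expressions. -/
inductive RExp where
  | ofNat (e : NExp)
  | var (x : ℕ)
  | get (a : ℕ) (i : NExp)
  | add (e f : RExp)
  | sub (e f : RExp)
  | mul (e f : RExp)
  | div (e f : RExp)
  | sqrt (e : RExp)
  | exp (e : RExp)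

/-- Tests. -/
inductive BExp where
  | nlt (e f : NExp)
  | rlt (e f : RExp)
  | neg (b : BExp)
  | conj (b c : BExp)

/-- Programs. -/
inductive Cmd where
  | skip
  | nset (x : ℕ) (e : NExp)
  | rset (x : ℕ) (e : RExp)
  | nput (a : ℕ) (i : NExp) (e : NExp)
  | rput (a : ℕ) (i : NExp) (e : RExp)
  | seq (c c' : Cmd)
  | ite (b : BExp) (c c' : Cmd)
  | loop (b : BExp) (c : Cmd)

def NExp.eval (s : Store) : NExp → ℕ
  | .const k => k
  | .var x => s.nvar x
  | .get a i => s.narr a (i.eval s)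
  | .add e f => e.eval s + f.eval s
  | .sub e f => e.eval s - f.eval s

noncomputable def RExp.eval (s : Store) : RExp → ℝ
  | .ofNat e => (e.eval s : ℝ)
  | .var x => s.rvar x
  | .get a i => s.rarr a (i.eval s)
  | .add e f => e.eval s + f.eval s
  | .sub e f => e.eval s - f.eval s
  | .mul e f => e.eval s * f.eval s
  | .div e f => e.eval s / f.eval s
  | .sqrt e => Real.sqrt (e.eval s)
  | .exp e => Real.exp (e.eval s)

def BExp.holds (s : Store) : BExp → Prop
  | .nlt e f => e.eval s < f.eval s
  | .rlt e f => e.eval s < f.eval s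
  | .neg b => ¬ b.holds s
  | .conj b c => b.holds s ∧ c.holds s

/-- The number of steps that the evaluation of an expression takes: its number of nodes. -/
def NExp.cost : NExp → ℕ
  | .const _ => 1
  | .var _ => 1
  | .get _ i => i.cost + 1
  | .add e f => e.cost + f.cost + 1
  | .sub e f => e.cost + f.cost + 1

/-- The number of nodes. -/
def RExp.cost : RExp → ℕ
  | .ofNat e => e.cost + 1
  | .var _ => 1
  | .get _ i => i.cost + 1
  | .add e f => e.cost + f.cost + 1
  | .sub e f => e.cost + f.cost + 1
  | .mul e f => e.cost + f.cost + 1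
  | .div e f => e.cost + f.cost + 1
  | .sqrt e => e.cost + 1
  | .exp e => e.cost + 1

/-- The number of nodes. -/
def BExp.cost : BExp → ℕ
  | .nlt e f => e.cost + f.cost + 1
  | .rlt e f => e.cost + f.cost + 1
  | .neg b => b.cost + 1
  | .conj b c => b.cost + c.cost + 1

namespace Store

def setN (s : Store) (x : ℕ) (k : ℕ) : Store :=
  { s with nvar := Function.update s.nvar x k }

def setR (s : Store) (x : ℕ) (r : ℝ) : Store :=
  { s with rvar := Function.update s.rvar x r }

def putN (s : Store) (a i : ℕ) (k : ℕ) : Store :=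
  { s with narr := Function.update s.narr a (Function.update (s.narr a) i k) }

def putR (s : Store) (a i : ℕ) (r : ℝ) : Store :=
  { s with rarr := Function.update s.rarr a (Function.update (s.rarr a) i r) }

end Store

/-- `Exec c s s' t`: the program `c`, started with memory `s`, halts with memory `s'` after exactly
`t` steps. -/
inductive Exec : Cmd → Store → Store → ℕ → Prop where
  | skip (s : Store) : Exec .skip s s 1
  | nset (s : Store) (x : ℕ) (e : NExp) :
      Exec (.nset x e) s (s.setN x (e.eval s)) (e.cost + 1)
  | rset (s : Store) (x : ℕ) (e : RExp) :
      Exec (.rset x e) s (s.setR x (e.eval s)) (e.cost + 1)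
  | nput (s : Store) (a : ℕ) (i e : NExp) :
      Exec (.nput a i e) s (s.putN a (i.eval s) (e.eval s)) (i.cost + e.cost + 1)
  | rput (s : Store) (a : ℕ) (i : NExp) (e : RExp) :
      Exec (.rput a i e) s (s.putR a (i.eval s) (e.eval s)) (i.cost + e.cost + 1)
  | seq {c c' : Cmd} {s s' s'' : Store} {t t' : ℕ} (h : Exec c s s' t) (h' : Exec c' s' s'' t') :
      Exec (.seq c c') s s'' (t + t')
  | ite_true {b : BExp} {c c' : Cmd} {s s' : Store} {t : ℕ} (hb : b.holds s)
      (h : Exec c s s' t) : Exec (.ite b c c') s s' (b.cost + t + 1)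
  | ite_false {b : BExp} {c c' : Cmd} {s s' : Store} {t : ℕ} (hb : ¬ b.holds s)
      (h : Exec c' s s' t) : Exec (.ite b c c') s s' (b.cost + t + 1)
  | loop_true {b : BExp} {c : Cmd} {s s' s'' : Store} {t t' : ℕ} (hb : b.holds s)
      (h : Exec c s s' t) (h' : Exec (.loop b c) s' s'' t') :
      Exec (.loop b c) s s'' (b.cost + t + t' + 1)
  | loop_false {b : BExp} {c : Cmd} {s : Store} (hb : ¬ b.holds s) :
      Exec (.loop b c) s s (b.cost + 1)

/-- The machine is deterministic: final memory and number of steps are determined by the program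
and the initial memory. -/
theorem Exec.deterministic {c : Cmd} {s s₁ : Store} {t₁ : ℕ} (h : Exec c s s₁ t₁) :
    ∀ {s₂ : Store} {t₂ : ℕ}, Exec c s s₂ t₂ → s₁ = s₂ ∧ t₁ = t₂ := by
  induction h with
  | skip => intro _ _ h₂; cases h₂; exact ⟨rfl, rfl⟩
  | nset => intro _ _ h₂; cases h₂; exact ⟨rfl, rfl⟩
  | rset => intro _ _ h₂; cases h₂; exact ⟨rfl, rfl⟩
  | nput => intro _ _ h₂; cases h₂; exact ⟨rfl, rfl⟩
  | rput => intro _ _ h₂; cases h₂; exact ⟨rfl, rfl⟩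
  | seq _ _ ih ih' =>
    intro _ _ h₂
    cases h₂ with
    | seq g g' =>
      obtain ⟨rfl, rfl⟩ := ih g
      obtain ⟨rfl, rfl⟩ := ih' g'
      exact ⟨rfl, rfl⟩
  | ite_true hb _ ih =>
    intro _ _ h₂
    cases h₂ with
    | ite_true _ g => obtain ⟨rfl, rfl⟩ := ih g; exact ⟨rfl, rfl⟩
    | ite_false hb' _ => exact absurd hb hb'
  | ite_false hb _ ih =>
    intro _ _ h₂
    cases h₂ with
    | ite_true hb' _ => exact absurd hb' hb
    | ite_false _ g => obtain ⟨rfl, rfl⟩ := ih g; exact ⟨rfl, rfl⟩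
  | loop_true hb _ _ ih ih' =>
    intro _ _ h₂
    cases h₂ with
    | loop_true _ g g' =>
      obtain ⟨rfl, rfl⟩ := ih g
      obtain ⟨rfl, rfl⟩ := ih' g'
      exact ⟨rfl, rfl⟩
    | loop_false hb' => exact absurd hb hb'
  | loop_false hb =>
    intro _ _ h₂
    cases h₂ with
    | loop_true hb' _ _ => exact absurd hb' hb
    | loop_false _ => exact ⟨rfl, rfl⟩

end RealRAM

/-!  Smallest intersecting balls. -/

namespace SIB

/-- Feasibility for the smallest intersecting ball problem: `r ≥ 0` and there are points
`v i ∈ Ω i` with `‖z - v i‖ ≤ r` for all `i`, so that the closed ball `B(z, r)` meets every `Ω i`. -/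
def Feasible {n d : ℕ} (Ω : Fin n → Set (EuclideanSpace ℝ (Fin d)))
    (z : EuclideanSpace ℝ (Fin d)) (r : ℝ) : Prop :=
  0 ≤ r ∧ ∃ v : Fin n → EuclideanSpace ℝ (Fin d), ∀ i, v i ∈ Ω i ∧ ‖z - v i‖ ≤ r

/-- The optimal radius `r*`. -/
noncomputable def optRadius {n d : ℕ} (Ω : Fin n → Set (EuclideanSpace ℝ (Fin d))) : ℝ :=
  sInf {r : ℝ | ∃ z, Feasible Ω z r}

/-- `B(z, r)` is a `(1 + ε)`-approximate smallest intersecting ball of the sets `Ω i`. -/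
def IsApprox {n d : ℕ} (Ω : Fin n → Set (EuclideanSpace ℝ (Fin d))) (ε : ℝ)
    (z : EuclideanSpace ℝ (Fin d)) (r : ℝ) : Prop :=
  Feasible Ω z r ∧ r ≤ (1 + ε) * optRadius Ω

/-- The diameter `D` of the input. -/
noncomputable def diameter {n d : ℕ} (Ω : Fin n → Set (EuclideanSpace ℝ (Fin d))) : ℝ :=
  Metric.diam (convexHull ℝ (⋃ i, Ω i))

/-- The ratio `R = D / r*`. -/
noncomputable def ratio {n d : ℕ} (Ω : Fin n → Set (EuclideanSpace ℝ (Fin d))) : ℝ :=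
  diameter Ω / optRadius Ω

/-- The convex polytopes spanned by finite point sets. -/
def polytopes {n d : ℕ} (P : Fin n → Finset (EuclideanSpace ℝ (Fin d))) :
    Fin n → Set (EuclideanSpace ℝ (Fin d)) :=
  fun i => convexHull ℝ (P i : Set (EuclideanSpace ℝ (Fin d)))

/-- The number of nonzero coordinates of a point. -/
noncomputable def nnz {d : ℕ} (p : EuclideanSpace ℝ (Fin d)) : ℕ :=
  {j : Fin d | p j ≠ 0}.ncard

/-- The number `N` of nonzero coordinates in the input sets. -/
noncomputable def totalNnz {n d : ℕ} (P : Fin n → Finset (EuclideanSpace ℝ (Fin d))) : ℕ :=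
  ∑ i, ∑ p ∈ P i, nnz p

/-- The least radius of a ball that encloses all points `c i`. -/
noncomputable def enclosingRadius {n d : ℕ} (c : Fin n → EuclideanSpace ℝ (Fin d)) : ℝ :=
  sInf {r : ℝ | 0 ≤ r ∧ ∃ z : EuclideanSpace ℝ (Fin d), ∀ i, ‖z - c i‖ ≤ r}

/-- The distance `inf {‖x - y‖ : x ∈ A, y ∈ B}` of two sets. -/
noncomputable def setDist {d : ℕ} (A B : Set (EuclideanSpace ℝ (Fin d))) : ℝ :=
  sInf {δ : ℝ | ∃ x ∈ A, ∃ y ∈ B, δ = ‖x - y‖}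

/-- The memory `s` holds the error parameter `ε` and the point sets `P`, in compressed sparse row
format. The points are numbered `0, 1, …` group by group, without repetition and in any order
within a group; `q t` is point number `t`.
* natural variables `0`, `1`: the numbers `n` and `d`; real variable `0`: the number `ε`;
* natural array `0`: cell `i` is the number of the first point of group `i` (cell `n`: the number
  of all points);
* natural array `1`: cell `t` is the position of the first entry of point `t`, which has exactly
  `nnz (q t)` entries;
* natural array `2` and real array `0`: coordinate index and value of each entry, one entry for each
  nonzero coordinate of the point, in any order.
All other cells are arbitrary. -/
def Encodes {n d : ℕ} (P : Fin n → Finset (EuclideanSpace ℝ (Fin d))) (ε : ℝ)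
    (s : RealRAM.Store) : Prop :=
  s.nvar 0 = n ∧ s.nvar 1 = d ∧ s.rvar 0 = ε ∧
  ∃ q : ℕ → EuclideanSpace ℝ (Fin d),
    s.narr 0 0 = 0 ∧
    (∀ i : Fin n, s.narr 0 ((i : ℕ) + 1) = s.narr 0 i + (P i).card) ∧
    (∀ i : Fin n, q '' Ico (s.narr 0 i) (s.narr 0 ((i : ℕ) + 1)) = P i) ∧
    s.narr 1 0 = 0 ∧
    (∀ t < s.narr 0 n, s.narr 1 (t + 1) = s.narr 1 t + nnz (q t)) ∧
    (∀ t < s.narr 0 n, ∀ j : Fin d, q t j ≠ 0 →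
      ∃ e ∈ Ico (s.narr 1 t) (s.narr 1 (t + 1)), s.narr 2 e = j ∧ s.rarr 0 e = q t j)

/-- The center of the output ball: cells `0, …, d - 1` of real array `1`. -/
def outCenter (d : ℕ) (s : RealRAM.Store) : EuclideanSpace ℝ (Fin d) :=
  WithLp.toLp 2 fun j : Fin d => s.rarr 1 j

/-- The radius of the output ball: real variable `1`. -/
def outRadius (s : RealRAM.Store) : ℝ := s.rvar 1

end SIB

/-! The problem is treated as a zero-sum game and solved by multiplicative weights with
vector-valued gains. In each round a center `z` and points `v i ∈ Ω i` are chosen, and group `i`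
accumulates the gain `G i`, the sum of the differences `z - v i`. Averaging over `t` rounds, the
mean of the points of group `i` stays in `Ω i` by convexity and lies at distance `‖G i‖ / t` from
the mean center. Hence the largest `‖G i‖ / t` is always the radius of an intersecting ball
(`Progress.feasible`), and it remains to keep all gains close to `t * r*`.

The potential is the sum of `cosh (η ‖G i‖)`. Its gradient weights group `i` by `sinh (η ‖G i‖) / ‖G
i‖` times `G i`. Against these weights both players can respond optimally in closed form: the center
minimizes a linear form over a ball (`bestCenter`), and each group maximizes a linear form over its
finitely many points. Comparison with a nearly optimal ball shows that the weighted gain is at most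
`r*` times the sum of the `sinh` terms (`sum_bestResponse_le`), so the potential grows by a factor
of at most `exp (η r* + (η L)²)` when every increment has norm at most `L` (`sum_cosh_step`). The
vector estimate reduces to the scalar one because `cosh ∘ √` is convex.

Neither `r*` nor the number of rounds is known in advance, so the learning rate decreases like `√(ℓ
/ (ℓ + t)) / L`; `sum_cosh_mono` permits lowering it. The outcome is `‖G i‖ ≤ t r* + 5 L √(ℓ (ℓ +
t))` (`PotentialBound.norm_le`), where `ℓ = ⌈log₂ n⌉`, `L = 4ρ`, and `ρ ≤ D` is the largest distance
from point `0`. The loop stops once this error term is at most `ε / 2` of the largest gain, which is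
a test on computed quantities only. Since the largest gain is at least `t r*`, this happens after
`O(R² ℓ / ε²)` rounds (`rounds_lt`).

A round costs `O(N + n d)`: sparse points are only scanned, and the dense gains are updated row by
row. A small program logic (`Runs`, with a frame rule) transfers this to the machine, and
`runs_sibCmd` joins the two sides. The special cases follow by bounding `R` or `N`, or by
identifying `r*` with the quantity sought. -/

namespace SIB

/-! ### The hyperbolic cosine potential of vector-valued gains -/

section Potential

/-- The power series of `cosh (√s)` is the sum of `s ^ k / (2k)!`, a nonnegative combination of
functions convex on `s ≥ 0`. -/
theorem convexOn_cosh_sqrt : ConvexOn ℝ (Ici 0) fun s : ℝ => Real.cosh (√s) := by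
  have key : ∀ s : ℝ, 0 ≤ s → HasSum (fun k : ℕ => s ^ k / ((2 * k).factorial : ℝ))
      (Real.cosh (√s)) := by
    intro s hs
    have h := Real.hasSum_cosh (√s)
    simpa only [pow_mul, Real.sq_sqrt hs] using h
  refine ⟨convex_Ici 0, ?_⟩
  intro x hx y hy a b ha hb hab
  have hx' : (0 : ℝ) ≤ x := hx
  have hy' : (0 : ℝ) ≤ y := hy
  have hz : 0 ≤ a • x + b • y := by simp only [smul_eq_mul]; positivity
  refine hasSum_le ?_ (key _ hz) (((key x hx').mul_left a).add ((key y hy').mul_left b))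
  intro k
  have h := (convexOn_pow (𝕜 := ℝ) k).2 hx hy ha hb hab
  simp only [smul_eq_mul] at h ⊢
  calc (a * x + b * y) ^ k / ((2 * k).factorial : ℝ)
      ≤ (a * x ^ k + b * y ^ k) / ((2 * k).factorial : ℝ) := by gcongr
    _ = _ := by ring

variable {E : Type*} [NormedAddCommGroup E] [InnerProductSpace ℝ E]

/-- Second-order Taylor bounds, from `exp b ≤ 1 + b + b²`, the addition formulas and `sinh a ≤ cosh
a`. They are the collinear cases of the next estimate. -/
theorem cosh_add_le {a b : ℝ} (ha : 0 ≤ a) (hb : 0 ≤ b) (hb1 : b ≤ 1) :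
    Real.cosh (a + b) ≤ Real.cosh a * (1 + b ^ 2) + Real.sinh a * b ∧
    Real.cosh (a - b) ≤ Real.cosh a * (1 + b ^ 2) - Real.sinh a * b := by
  have h1 := (abs_le.1 (Real.abs_exp_sub_one_sub_id_le (x := b) (by rwa [abs_of_nonneg hb]))).2
  have h2 : Real.cosh b + Real.sinh b = Real.exp b := Real.cosh_add_sinh b
  have h3 : b ≤ Real.sinh b := Real.self_le_sinh_iff.2 hb
  have h4 : Real.sinh a ≤ Real.cosh a := (Real.sinh_lt_cosh a).le
  have h5 : 0 ≤ Real.sinh a := Real.sinh_nonneg_iff.2 ha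
  have h6 := Real.one_le_cosh b
  rw [Real.cosh_add, Real.cosh_sub]
  constructor
  · nlinarith [mul_le_mul_of_nonneg_right h4 (sub_nonneg.2 h3)]
  · nlinarith [mul_le_mul_of_nonneg_left h3 h5]

/-- If `c` is the cosine of the angle between `x` and `g`, then `‖x + g‖²` is the convex combination
of `(‖x‖ + ‖g‖)²` and `(‖x‖ - ‖g‖)²` with weights `(1 ± c) / 2`. Convexity of `cosh ∘ √` therefore
reduces the claim to the two collinear cases. -/
theorem cosh_norm_add_le (x g : E) (hg : ‖g‖ ≤ 1) :
    Real.cosh ‖x + g‖ ≤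
      Real.cosh ‖x‖ * (1 + ‖g‖ ^ 2) + Real.sinh ‖x‖ / ‖x‖ * inner ℝ x g := by
  rcases eq_or_ne x 0 with rfl | hx
  · simpa using (cosh_add_le le_rfl (norm_nonneg g) hg).1
  rcases eq_or_ne g 0 with rfl | hg0
  · simp
  have ha : 0 < ‖x‖ := norm_pos_iff.2 hx
  have hb : 0 < ‖g‖ := norm_pos_iff.2 hg0
  set a := ‖x‖
  set b := ‖g‖
  obtain ⟨hi1, hi2⟩ := abs_le.1 (abs_real_inner_le_norm x g)
  set c := inner ℝ x g / (a * b) with hc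
  have hin : inner ℝ x g = a * b * c := by rw [hc]; field_simp
  have hc1 : -1 ≤ c := by rw [hc, le_div_iff₀ (by positivity)]; linarith
  have hc2 : c ≤ 1 := by rw [hc, div_le_iff₀ (by positivity)]; linarith
  have hs : ‖x + g‖ = √(((1 + c) / 2) • (a + b) ^ 2 + ((1 - c) / 2) • (a - b) ^ 2) := by
    rw [← Real.sqrt_sq (norm_nonneg (x + g)), norm_add_sq_real, hin]
    congr 1
    simp only [smul_eq_mul]
    ring
  have hconv := convexOn_cosh_sqrt.2 (mem_Ici.2 (sq_nonneg (a + b))) (mem_Ici.2 (sq_nonneg (a - b)))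
    (by linarith : 0 ≤ (1 + c) / 2) (by linarith : 0 ≤ (1 - c) / 2) (by ring)
  simp only [Real.sqrt_sq_eq_abs, Real.cosh_abs, smul_eq_mul] at hconv
  obtain ⟨h1, h2⟩ := cosh_add_le ha.le hb.le hg
  have hr : Real.sinh a / a * inner ℝ x g = Real.sinh a * b * c := by rw [hin]; field_simp
  rw [hs, hr]
  simp only [smul_eq_mul]
  refine hconv.trans ?_
  nlinarith [mul_le_mul_of_nonneg_left h1 (by linarith : 0 ≤ (1 + c) / 2),
    mul_le_mul_of_nonneg_left h2 (by linarith : 0 ≤ (1 - c) / 2)]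

variable {ι : Type*} [Fintype ι]

/-- One step of the potential argument at a fixed learning rate: `hbr` controls the first-order term
and `L` the second-order one. Groups with `G i = 0` contribute nothing to the first-order sum, in
agreement with division by zero giving zero. -/
theorem sum_cosh_step (G g : ι → E) {η L r : ℝ} (hη : 0 < η) (hL : ∀ i, ‖g i‖ ≤ L)
    (hηL : η * L ≤ 1) (hr : 0 ≤ r)
    (hbr : ∑ i, Real.sinh (η * ‖G i‖) / ‖G i‖ * inner ℝ (G i) (g i) ≤
      r * ∑ i, Real.sinh (η * ‖G i‖)) :
    ∑ i, Real.cosh (η * ‖G i + g i‖) ≤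
      (∑ i, Real.cosh (η * ‖G i‖)) * Real.exp (η * r + (η * L) ^ 2) := by
  have hterm : ∀ i, Real.cosh (η * ‖G i + g i‖) ≤ Real.cosh (η * ‖G i‖) * (1 + (η * L) ^ 2) +
      η * (Real.sinh (η * ‖G i‖) / ‖G i‖ * inner ℝ (G i) (g i)) := by
    intro i
    have hn : ∀ x : E, ‖η • x‖ = η * ‖x‖ := fun x => by
      rw [norm_smul, Real.norm_of_nonneg hη.le]
    have hgi : ‖η • g i‖ ≤ η * L := by rw [hn]; exact mul_le_mul_of_nonneg_left (hL i) hη.le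
    have h := cosh_norm_add_le (η • G i) (η • g i) (hgi.trans hηL)
    rw [← smul_add, hn, hn, inner_smul_left, inner_smul_right] at h
    refine h.trans (add_le_add ?_ (le_of_eq ?_))
    · gcongr
    · rcases eq_or_ne (G i) 0 with h0 | h0
      · simp [h0]
      · have := norm_pos_iff.2 h0
        simp only [conj_trivial]
        field_simp
  have hsinh : ∑ i, Real.sinh (η * ‖G i‖) ≤ ∑ i, Real.cosh (η * ‖G i‖) :=
    Finset.sum_le_sum fun i _ => (Real.sinh_lt_cosh _).le
  have hΦ : 0 ≤ ∑ i, Real.cosh (η * ‖G i‖) := Finset.sum_nonneg fun i _ => (Real.cosh_pos _).le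
  calc ∑ i, Real.cosh (η * ‖G i + g i‖)
      ≤ ∑ i, (Real.cosh (η * ‖G i‖) * (1 + (η * L) ^ 2) +
          η * (Real.sinh (η * ‖G i‖) / ‖G i‖ * inner ℝ (G i) (g i))) :=
        Finset.sum_le_sum fun i _ => hterm i
    _ = (∑ i, Real.cosh (η * ‖G i‖)) * (1 + (η * L) ^ 2) +
          η * ∑ i, Real.sinh (η * ‖G i‖) / ‖G i‖ * inner ℝ (G i) (g i) := by
        rw [Finset.sum_add_distrib, Finset.sum_mul, Finset.mul_sum]
    _ ≤ (∑ i, Real.cosh (η * ‖G i‖)) * (1 + (η * L) ^ 2) +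
          η * (r * ∑ i, Real.cosh (η * ‖G i‖)) := by
        gcongr
        exact hbr.trans (mul_le_mul_of_nonneg_left hsinh hr)
    _ = (∑ i, Real.cosh (η * ‖G i‖)) * (η * r + (η * L) ^ 2 + 1) := by ring
    _ ≤ _ := by gcongr; exact Real.add_one_le_exp _

/-- A power-mean inequality, which makes a decreasing learning rate harmless. With `θ = η' / η`,
convexity of `exp` between `η x i` (and its negative) and `η B` gives the bound termwise, and no
factor is lost on summation. -/
theorem sum_cosh_mono (x : ι → ℝ) {η η' B : ℝ} (hη' : 0 < η') (hle : η' ≤ η)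
    (h : ∑ i, Real.cosh (η * x i) ≤ Fintype.card ι * Real.exp (η * B)) :
    ∑ i, Real.cosh (η' * x i) ≤ Fintype.card ι * Real.exp (η' * B) := by
  have hη : 0 < η := hη'.trans_le hle
  set θ := η' / η with hθ
  have hθ0 : 0 ≤ θ := by positivity
  have hθ1 : 0 ≤ 1 - θ := by rw [sub_nonneg, hθ, div_le_one hη]; exact hle
  have hηθ : η' = θ * η := by rw [hθ]; field_simp
  have hexp : ∀ u : ℝ, Real.exp (θ * u) * Real.exp ((1 - θ) * (η * B)) ≤
      θ * Real.exp u + (1 - θ) * Real.exp (η * B) := by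
    intro u
    have := convexOn_exp.2 (mem_univ u) (mem_univ (η * B)) hθ0 hθ1 (by ring)
    simpa only [smul_eq_mul, Real.exp_add] using this
  have hcosh : ∀ i, Real.cosh (η' * x i) * Real.exp ((1 - θ) * (η * B)) ≤
      θ * Real.cosh (η * x i) + (1 - θ) * Real.exp (η * B) := by
    intro i
    have h1 := hexp (η * x i)
    have h2 := hexp (-(η * x i))
    rw [Real.cosh_eq, Real.cosh_eq, hηθ, mul_assoc, ← mul_neg]
    linarith
  have hsum := Finset.sum_le_sum fun i (_ : i ∈ Finset.univ) => hcosh i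
  rw [← Finset.sum_mul, Finset.sum_add_distrib, ← Finset.mul_sum, Finset.sum_const,
    Finset.card_univ, nsmul_eq_mul] at hsum
  have hpos := Real.exp_pos ((1 - θ) * (η * B))
  refine le_of_mul_le_mul_right ?_ hpos
  rw [mul_assoc, ← Real.exp_add, show η' * B + (1 - θ) * (η * B) = η * B by rw [hηθ]; ring]
  nlinarith

end Potential

/-! ### Decreasing learning rates and the growth of the gains -/

/-- The learning rate of round `t`, for `2 ^ ℓ ≥ n` sets and width `L`. -/
noncomputable def rate (ℓ L t : ℝ) : ℝ := √(ℓ / (ℓ + t)) / L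

section Rounds

variable {E : Type*} [NormedAddCommGroup E] {ι : Type*} [Fintype ι]

theorem rate_pos {ℓ L t : ℝ} (hℓ : 1 ≤ ℓ) (hL : 0 < L) (ht : 0 ≤ t) : 0 < rate ℓ L t := by
  unfold rate; positivity

theorem rate_eq {ℓ L t : ℝ} (hℓ : 1 ≤ ℓ) (ht : 0 ≤ t) :
    rate ℓ L t * √(ℓ * (ℓ + t)) = ℓ / L := by
  have h : √(ℓ / (ℓ + t)) * √(ℓ * (ℓ + t)) = ℓ := by
    rw [← Real.sqrt_mul (by positivity), show ℓ / (ℓ + t) * (ℓ * (ℓ + t)) = ℓ ^ 2 by field_simp]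
    exact Real.sqrt_sq (by linarith)
  rw [rate, div_mul_eq_mul_div, h]

theorem rate_mul_le_one {ℓ L t : ℝ} (hℓ : 1 ≤ ℓ) (hL : 0 < L) (ht : 0 ≤ t) :
    rate ℓ L t * L ≤ 1 := by
  rw [rate, div_mul_cancel₀ _ hL.ne', Real.sqrt_le_one, div_le_one (by linarith)]
  linarith

theorem rate_anti {ℓ L t : ℝ} (hℓ : 1 ≤ ℓ) (hL : 0 < L) (ht : 0 ≤ t) :
    rate ℓ L (t + 1) ≤ rate ℓ L t := by
  unfold rate
  gcongr
  linarith

/-- The second-order errors sum up to a square root. With `u = √(ℓ + t)` and `v = √(ℓ + t + 1)` the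
claim is `1 / u ≤ 3 (v - u)`; it holds because `v² - u² = 1` and `v ≤ 2u`, the latter by `ℓ + t ≥
1`. -/
theorem rate_mul_sq_le {ℓ L t : ℝ} (hℓ : 1 ≤ ℓ) (hL : 0 < L) (ht : 0 ≤ t) :
    3 * L * √(ℓ * (ℓ + t)) + rate ℓ L t * L ^ 2 ≤ 3 * L * √(ℓ * (ℓ + (t + 1))) := by
  have hm : 0 < ℓ + t := by linarith
  have h1 : rate ℓ L t * L ^ 2 = L * (√ℓ / √(ℓ + t)) := by
    rw [rate, Real.sqrt_div (by linarith)]; field_simp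
  rw [h1, Real.sqrt_mul (by linarith), Real.sqrt_mul (by linarith), ← add_assoc]
  have hs := Real.sqrt_pos.2 hm
  have hsq := Real.sq_sqrt hm.le
  have hsq' := Real.sq_sqrt (by linarith : 0 ≤ ℓ + t + 1)
  have hs' := Real.sqrt_nonneg (ℓ + t + 1)
  set u := √(ℓ + t)
  set v := √(ℓ + t + 1)
  have huv : v ≤ 2 * u := by
    refine abs_le_of_sq_le_sq' (by nlinarith) (by positivity) |>.2
  have key : 3 * u + 1 / u ≤ 3 * v := by
    have : u * (3 * u + 1 / u) ≤ u * (3 * v) := by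
      have : u * (3 * u + 1 / u) = 3 * u ^ 2 + 1 := by field_simp
      rw [this]
      have hle : u ≤ v := Real.sqrt_le_sqrt (by linarith)
      nlinarith
    exact le_of_mul_le_mul_left this hs
  have := mul_le_mul_of_nonneg_left key (by positivity : 0 ≤ L * √ℓ)
  calc _ = L * √ℓ * (3 * u + 1 / u) := by ring
    _ ≤ _ := this
    _ = _ := by ring

/-- The invariant of the multiplicative-weights method. -/
def PotentialBound (ℓ L r : ℝ) (t : ℕ) (G : ι → E) : Prop :=
  ∑ i, Real.cosh (rate ℓ L t * ‖G i‖) ≤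
    Fintype.card ι * Real.exp (rate ℓ L t * (t * r + 3 * L * √(ℓ * (ℓ + t))))

/-- A single term is at most the whole potential, and `exp x ≤ 2 cosh x`. Taking logarithms costs
`log (2n) ≤ 2ℓ`, which after division by the rate is `2 L √(ℓ (ℓ + t))`; this raises the constant
from 3 to 5. -/
theorem PotentialBound.norm_le {ℓ L r : ℝ} (hℓ : 1 ≤ ℓ) (hL : 0 < L) {t : ℕ} {G : ι → E}
    (hn : Real.log (2 * Fintype.card ι) ≤ 2 * ℓ) (h : PotentialBound ℓ L r t G) (i : ι) :
    ‖G i‖ ≤ t * r + 5 * L * √(ℓ * (ℓ + t)) := by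
  have ht : (0 : ℝ) ≤ t := t.cast_nonneg
  have hη := rate_pos hℓ hL ht
  have hcard : (0 : ℝ) < Fintype.card ι := by
    exact_mod_cast Fintype.card_pos_iff.2 ⟨i⟩
  have h1 : Real.cosh (rate ℓ L t * ‖G i‖) ≤ _ :=
    (Finset.single_le_sum (f := fun i => Real.cosh (rate ℓ L t * ‖G i‖))
      (fun i _ => (Real.cosh_pos _).le) (Finset.mem_univ i)).trans h
  rw [Real.cosh_eq] at h1
  have h2 : Real.exp (rate ℓ L t * ‖G i‖) ≤ 2 * Fintype.card ι *
      Real.exp (rate ℓ L t * (t * r + 3 * L * √(ℓ * (ℓ + t)))) := by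
    have := Real.exp_pos (-(rate ℓ L t * ‖G i‖))
    linarith
  have h3 := Real.log_le_log (Real.exp_pos _) h2
  rw [Real.log_exp, Real.log_mul (by positivity) (Real.exp_ne_zero _), Real.log_exp] at h3
  have h4 : rate ℓ L t * (2 * L * √(ℓ * (ℓ + t))) = 2 * ℓ := by
    have := rate_eq (L := L) hℓ ht
    calc _ = 2 * L * (rate ℓ L t * √(ℓ * (ℓ + t))) := by ring
      _ = _ := by rw [this]; field_simp
  refine le_of_mul_le_mul_left ?_ hη
  calc _ ≤ _ := h3
    _ ≤ rate ℓ L t * (2 * L * √(ℓ * (ℓ + t))) +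
        rate ℓ L t * (t * r + 3 * L * √(ℓ * (ℓ + t))) := by rw [h4]; gcongr
    _ = _ := by ring

theorem potentialBound_zero {ℓ L r : ℝ} (hℓ : 1 ≤ ℓ) (hL : 0 < L) :
    PotentialBound ℓ L r 0 (0 : ι → E) := by
  have := rate_pos hℓ hL le_rfl
  simp only [PotentialBound, Pi.zero_apply, norm_zero, mul_zero, Real.cosh_zero, Finset.sum_const,
    Finset.card_univ, nsmul_eq_mul, mul_one, Nat.cast_zero]
  rw [zero_mul, zero_add]
  refine le_mul_of_one_le_right (by positivity) (Real.one_le_exp (by positivity))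

variable [InnerProductSpace ℝ E]

/-- The step is made at the rate of round `t`, its error `(η L)²` is absorbed by the growth of the
square root, and only then is the rate lowered to that of round `t + 1`. -/
theorem PotentialBound.step {ℓ L r : ℝ} (hℓ : 1 ≤ ℓ) (hL : 0 < L) (hr : 0 ≤ r) {t : ℕ}
    {G g : ι → E} (h : PotentialBound ℓ L r t G) (hg : ∀ i, ‖g i‖ ≤ L)
    (hbr : ∑ i, Real.sinh (rate ℓ L t * ‖G i‖) / ‖G i‖ * inner ℝ (G i) (g i) ≤
      r * ∑ i, Real.sinh (rate ℓ L t * ‖G i‖)) :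
    PotentialBound ℓ L r (t + 1) fun i => G i + g i := by
  have ht : (0 : ℝ) ≤ t := t.cast_nonneg
  have hη := rate_pos hℓ hL ht
  unfold PotentialBound at *
  push_cast
  refine sum_cosh_mono _ (rate_pos hℓ hL (by positivity)) (rate_anti hℓ hL ht) ?_
  refine (sum_cosh_step G g hη hg (rate_mul_le_one hℓ hL ht) hr hbr).trans ?_
  refine (mul_le_mul_of_nonneg_right h (Real.exp_pos _).le).trans ?_
  rw [mul_assoc, ← Real.exp_add]
  gcongr
  have := mul_le_mul_of_nonneg_left (rate_mul_sq_le hℓ hL ht) hη.le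
  nlinarith

end Rounds

end SIB

namespace RealRAM

/-! A program logic for total correctness with time bounds. -/

/-- Started in `s`, the program halts within `T` steps in a memory that satisfies `Q`. -/
def Runs (c : Cmd) (s : Store) (T : ℕ) (Q : Store → Prop) : Prop :=
  ∃ s' t, Exec c s s' t ∧ t ≤ T ∧ Q s'

theorem Runs.mono {c : Cmd} {s : Store} {T T' : ℕ} {Q Q' : Store → Prop} (h : Runs c s T Q)
    (hT : T ≤ T') (hQ : ∀ s', Q s' → Q' s') : Runs c s T' Q' := by
  obtain ⟨s', t, he, ht, hq⟩ := h
  exact ⟨s', t, he, ht.trans hT, hQ s' hq⟩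

theorem Runs.seq {c c' : Cmd} {s : Store} {T T' : ℕ} {Q Q' : Store → Prop} (h : Runs c s T Q)
    (h' : ∀ s', Q s' → Runs c' s' T' Q') : Runs (.seq c c') s (T + T') Q' := by
  obtain ⟨s', t, he, ht, hq⟩ := h
  obtain ⟨s'', t', he', ht', hq'⟩ := h' s' hq
  exact ⟨s'', t + t', .seq he he', by lia, hq'⟩

theorem Runs.skip (s : Store) : Runs .skip s 1 fun s' => s' = s :=
  ⟨s, 1, .skip s, le_rfl, rfl⟩

theorem Runs.nset (s : Store) (x : ℕ) (e : NExp) :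
    Runs (.nset x e) s (e.cost + 1) fun s' => s' = s.setN x (e.eval s) :=
  ⟨_, _, .nset s x e, le_rfl, rfl⟩

theorem Runs.rset (s : Store) (x : ℕ) (e : RExp) :
    Runs (.rset x e) s (e.cost + 1) fun s' => s' = s.setR x (e.eval s) :=
  ⟨_, _, .rset s x e, le_rfl, rfl⟩

theorem Runs.rput (s : Store) (a : ℕ) (i : NExp) (e : RExp) :
    Runs (.rput a i e) s (i.cost + e.cost + 1) fun s' => s' = s.putR a (i.eval s) (e.eval s) :=
  ⟨_, _, .rput s a i e, le_rfl, rfl⟩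

theorem Runs.ite {b : BExp} {c c' : Cmd} {s : Store} {T : ℕ} {Q : Store → Prop}
    (h : b.holds s → Runs c s T Q) (h' : ¬ b.holds s → Runs c' s T Q) :
    Runs (.ite b c c') s (b.cost + T + 1) Q := by
  by_cases hb : b.holds s
  · obtain ⟨s', t, he, ht, hq⟩ := h hb
    exact ⟨s', _, .ite_true hb he, by lia, hq⟩
  · obtain ⟨s', t, he, ht, hq⟩ := h' hb
    exact ⟨s', _, .ite_false hb he, by lia, hq⟩

/-- Loop rule: `I k` is the invariant after `k` rounds, `T k` the time spent on them, and `K` bounds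
the number of rounds. -/
theorem Runs.loop {b : BExp} {c : Cmd} {I : ℕ → Store → Prop} {T : ℕ → ℕ} {K : ℕ}
    (hstep : ∀ k s, I k s → b.holds s → k < K ∧
      ∃ t, T k + t + b.cost + 1 ≤ T (k + 1) ∧ Runs c s t (I (k + 1)))
    (hexit : ∀ k s, I k s → ¬ b.holds s → T k ≤ T K) {k : ℕ} {s : Store} (hI : I k s) {U : ℕ}
    (hU : T K + b.cost + 1 ≤ U + T k) :
    Runs (.loop b c) s U fun s' => ∃ k', I k' s' ∧ ¬ b.holds s' := by
  induction hm : K - k generalizing k s U with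
  | zero =>
    by_cases hb : b.holds s
    · have := (hstep k s hI hb).1
      lia
    · have := hexit k s hI hb
      exact ⟨s, _, .loop_false hb, by lia, k, hI, hb⟩
  | succ m ih =>
    by_cases hb : b.holds s
    · obtain ⟨hk, t, ht, s', t', he, ht', hI'⟩ := hstep k s hI hb
      obtain ⟨s'', t'', he', ht'', hq⟩ :=
        ih (k := k + 1) hI' (U := T K + b.cost + 1 - T (k + 1)) (by lia) (by lia)
      refine ⟨s'', _, .loop_true hb he he', ?_, hq⟩
      obtain ⟨k', hk', hb'⟩ := hq
      have := hexit k' s'' hk' hb'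
      -- `T` is not assumed monotone, so the subtraction in the time bound may truncate to zero. In
      -- that case the rest of the loop would take zero steps, which no execution of a loop does.
      by_cases hle : T (k + 1) ≤ T K + b.cost + 1
      · lia
      · exfalso
        have : t'' = 0 := by lia
        subst this
        cases he'
    · have := hexit k s hI hb
      exact ⟨s, _, .loop_false hb, by lia, k, hI, hb⟩

/-- The natural-number variables that a program writes to. -/
def Cmd.modN : Cmd → List ℕ
  | .skip => []
  | .nset x _ => [x]
  | .rset _ _ => []
  | .nput _ _ _ => []
  | .rput _ _ _ => []
  | .seq c c' => c.modN ++ c'.modN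
  | .ite _ c c' => c.modN ++ c'.modN
  | .loop _ c => c.modN

/-- The real variables that a program writes to. -/
def Cmd.modR : Cmd → List ℕ
  | .skip => []
  | .nset _ _ => []
  | .rset x _ => [x]
  | .nput _ _ _ => []
  | .rput _ _ _ => []
  | .seq c c' => c.modR ++ c'.modR
  | .ite _ c c' => c.modR ++ c'.modR
  | .loop _ c => c.modR

/-- The natural-number arrays that a program writes to. -/
def Cmd.modNArr : Cmd → List ℕ
  | .skip => []
  | .nset _ _ => []
  | .rset _ _ => []
  | .nput a _ _ => [a]
  | .rput _ _ _ => []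
  | .seq c c' => c.modNArr ++ c'.modNArr
  | .ite _ c c' => c.modNArr ++ c'.modNArr
  | .loop _ c => c.modNArr

/-- The real arrays that a program writes to. -/
def Cmd.modRArr : Cmd → List ℕ
  | .skip => []
  | .nset _ _ => []
  | .rset _ _ => []
  | .nput _ _ _ => []
  | .rput a _ _ => [a]
  | .seq c c' => c.modRArr ++ c'.modRArr
  | .ite _ c c' => c.modRArr ++ c'.modRArr
  | .loop _ c => c.modRArr

/-- The two memories agree outside the given variables and arrays. -/
structure Agree (X Y A B : List ℕ) (s s' : Store) : Prop where
  nvar : ∀ x ∉ X, s'.nvar x = s.nvar x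
  rvar : ∀ x ∉ Y, s'.rvar x = s.rvar x
  narr : ∀ a ∉ A, s'.narr a = s.narr a
  rarr : ∀ a ∉ B, s'.rarr a = s.rarr a

theorem Agree.refl (X Y A B : List ℕ) (s : Store) : Agree X Y A B s s :=
  ⟨fun _ _ => rfl, fun _ _ => rfl, fun _ _ => rfl, fun _ _ => rfl⟩

theorem Agree.trans {X Y A B : List ℕ} {s s' s'' : Store} (h : Agree X Y A B s s')
    (h' : Agree X Y A B s' s'') : Agree X Y A B s s'' :=
  ⟨fun x hx => (h'.nvar x hx).trans (h.nvar x hx), fun x hx => (h'.rvar x hx).trans (h.rvar x hx),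
    fun x hx => (h'.narr x hx).trans (h.narr x hx), fun x hx => (h'.rarr x hx).trans (h.rarr x hx)⟩

theorem Agree.mono {X Y A B X' Y' A' B' : List ℕ} {s s' : Store} (h : Agree X Y A B s s')
    (hX : X ⊆ X') (hY : Y ⊆ Y') (hA : A ⊆ A') (hB : B ⊆ B') : Agree X' Y' A' B' s s' :=
  ⟨fun x hx => h.nvar x fun hm => hx (hX hm), fun x hx => h.rvar x fun hm => hx (hY hm),
    fun x hx => h.narr x fun hm => hx (hA hm), fun x hx => h.rarr x fun hm => hx (hB hm)⟩

/-- A program changes only what it writes to. -/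
theorem Exec.agree {c : Cmd} {s s' : Store} {t : ℕ} (h : Exec c s s' t) :
    Agree c.modN c.modR c.modNArr c.modRArr s s' := by
  induction h with
  | skip s => exact .refl _ _ _ _ s
  | nset s x e =>
    refine ⟨fun y hy => ?_, fun _ _ => rfl, fun _ _ => rfl, fun _ _ => rfl⟩
    exact Function.update_of_ne (by simpa [Cmd.modN] using hy) _ _
  | rset s x e =>
    refine ⟨fun _ _ => rfl, fun y hy => ?_, fun _ _ => rfl, fun _ _ => rfl⟩
    exact Function.update_of_ne (by simpa [Cmd.modR] using hy) _ _
  | nput s a i e =>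
    refine ⟨fun _ _ => rfl, fun _ _ => rfl, fun y hy => ?_, fun _ _ => rfl⟩
    exact Function.update_of_ne (by simpa [Cmd.modNArr] using hy) _ _
  | rput s a i e =>
    refine ⟨fun _ _ => rfl, fun _ _ => rfl, fun _ _ => rfl, fun y hy => ?_⟩
    exact Function.update_of_ne (by simpa [Cmd.modRArr] using hy) _ _
  | seq _ _ ih ih' =>
    exact (ih.mono (List.subset_append_left _ _) (List.subset_append_left _ _)
      (List.subset_append_left _ _) (List.subset_append_left _ _)).trans
      (ih'.mono (List.subset_append_right _ _) (List.subset_append_right _ _)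
      (List.subset_append_right _ _) (List.subset_append_right _ _))
  | ite_true _ _ ih =>
    exact ih.mono (List.subset_append_left _ _) (List.subset_append_left _ _)
      (List.subset_append_left _ _) (List.subset_append_left _ _)
  | ite_false _ _ ih =>
    exact ih.mono (List.subset_append_right _ _) (List.subset_append_right _ _)
      (List.subset_append_right _ _) (List.subset_append_right _ _)
  | loop_true _ _ _ ih ih' => exact ih.trans ih'
  | loop_false => exact .refl _ _ _ _ _

/-- Weakening that remembers what the program leaves unchanged. -/
theorem Runs.frame {c : Cmd} {s : Store} {T T' : ℕ} {Q Q' : Store → Prop} (h : Runs c s T Q)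
    (hT : T ≤ T') (hQ : ∀ s', Agree c.modN c.modR c.modNArr c.modRArr s s' → Q s' → Q' s') :
    Runs c s T' Q' := by
  obtain ⟨s', t, he, ht, hq⟩ := h
  exact ⟨s', t, he, ht.trans hT, hQ s' he.agree hq⟩

namespace Store

/-- Overwrite a whole real array. -/
def setA (s : Store) (a : ℕ) (f : ℕ → ℝ) : Store :=
  { s with rarr := Function.update s.rarr a f }

variable (s : Store) (x y k a b i j : ℕ) (r : ℝ) (f : ℕ → ℝ)

@[simp] theorem nvar_setN : (s.setN x k).nvar y = if y = x then k else s.nvar y :=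
  Function.update_apply _ _ _ _
@[simp] theorem rvar_setN : (s.setN x k).rvar = s.rvar := rfl
@[simp] theorem narr_setN : (s.setN x k).narr = s.narr := rfl
@[simp] theorem rarr_setN : (s.setN x k).rarr = s.rarr := rfl
@[simp] theorem nvar_setR : (s.setR x r).nvar = s.nvar := rfl
@[simp] theorem rvar_setR : (s.setR x r).rvar y = if y = x then r else s.rvar y :=
  Function.update_apply _ _ _ _
@[simp] theorem narr_setR : (s.setR x r).narr = s.narr := rfl
@[simp] theorem rarr_setR : (s.setR x r).rarr = s.rarr := rfl
@[simp] theorem nvar_setA : (s.setA a f).nvar = s.nvar := rfl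
@[simp] theorem rvar_setA : (s.setA a f).rvar = s.rvar := rfl
@[simp] theorem narr_setA : (s.setA a f).narr = s.narr := rfl
@[simp] theorem rarr_setA : (s.setA a f).rarr b = if b = a then f else s.rarr b :=
  Function.update_apply _ _ _ _

end Store

/-! ### Counting loops: summation, mapping, and sparse subtraction -/

/-- `for x = lo, …, hi - 1 do c`. -/
def forLoop (x : ℕ) (lo hi : NExp) (c : Cmd) : Cmd :=
  .seq (.nset x lo) (.loop (.nlt (.var x) hi) (.seq c (.nset x (.add (.var x) (.const 1)))))

/-- The invariant `I k` speaks of the memory in which the counter already equals `k`. The overhead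
of `hi.cost + 7` per round pays for the test, the branch of the loop, and the increment. -/
theorem runs_forLoop {x : ℕ} {lo hi : NExp} {c : Cmd} {I : ℕ → Store → Prop} {T : ℕ → ℕ}
    {a b : ℕ} {s : Store} (hx : x ∉ c.modN) (hlo : lo.eval s = a) (hab : a ≤ b)
    (hI : I a (s.setN x a))
    (hhi : ∀ k s', a ≤ k → k ≤ b → I k s' → s'.nvar x = k → hi.eval s' = b)
    (hstep : ∀ k s', a ≤ k → k < b → I k s' → s'.nvar x = k →
      ∃ t, T k + t + hi.cost + 7 ≤ T (k + 1) ∧ Runs c s' t fun s'' => I (k + 1) (s''.setN x (k + 1)))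
    {U : ℕ} (hU : T b + lo.cost + hi.cost + 4 ≤ U + T a) :
    Runs (forLoop x lo hi c) s U fun s' => I b s' ∧ s'.nvar x = b := by
  -- The step hypothesis bounds `T` only along reachable memories, so monotonicity between `a` and
  -- `b` is obtained by following an actual run.
  have hTab : T a ≤ T b := by
    have hex : ∀ m, a ≤ m → m ≤ b → T a ≤ T m ∧ ∃ s', I m s' ∧ s'.nvar x = m := by
      intro m ham
      induction m, ham using Nat.le_induction with
      | base => exact fun _ => ⟨le_rfl, _, hI, by simp⟩
      | succ m ham ih =>
        intro hm
        obtain ⟨h1, s', h2, h3⟩ := ih (by lia)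
        obtain ⟨t, ht, s'', -, -, -, hs''⟩ := hstep m s' ham (by lia) h2 h3
        exact ⟨by lia, _, hs'', by simp⟩
    exact (hex b hab le_rfl).1
  have h := Runs.loop (b := .nlt (.var x) hi) (c := .seq c (.nset x (.add (.var x) (.const 1))))
    (I := fun k s' => (a ≤ k ∧ k ≤ b) ∧ I k s' ∧ s'.nvar x = k) (T := T) (K := b) (k := a)
    (s := s.setN x a) (U := T b + hi.cost + 3 - T a) ?_ ?_ ?_ ?_
  · refine ((Runs.nset s x lo).seq (Q' := fun s' => I b s' ∧ s'.nvar x = b) fun s' hs' => ?_).mono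
      (T := lo.cost + 1 + (T b + hi.cost + 3 - T a)) (by lia) fun _ h => h
    subst hs'
    rw [hlo]
    refine h.mono le_rfl ?_
    rintro s' ⟨k, ⟨⟨hak, hkb⟩, hk, hxk⟩, hb⟩
    have hh : hi.eval s' = b := hhi k s' hak hkb hk hxk
    simp only [BExp.holds, NExp.eval, hxk, hh] at hb
    obtain rfl : k = b := by lia
    exact ⟨hk, hxk⟩
  · rintro k s' ⟨⟨hak, hkb⟩, hk, hxk⟩ hb
    have hh : hi.eval s' = b := hhi k s' hak hkb hk hxk
    simp only [BExp.holds, NExp.eval, hxk, hh] at hb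
    refine ⟨hb, ?_⟩
    obtain ⟨t, ht, hr⟩ := hstep k s' hak hb hk hxk
    refine ⟨t + 4, by simp only [BExp.cost, NExp.cost]; lia, ?_⟩
    refine (hr.frame le_rfl (Q' := fun s'' => I (k + 1) (s''.setN x (k + 1)) ∧ s''.nvar x = k)
      fun s'' hag hs'' => ⟨hs'', (hag.nvar x hx).trans hxk⟩).seq ?_
    rintro s'' ⟨h1, h2⟩
    refine (Runs.nset _ _ _).mono (by simp [NExp.cost]) ?_
    rintro _ rfl
    simp only [NExp.eval, h2]
    exact ⟨⟨by lia, by lia⟩, h1, by simp⟩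
  · rintro k s' ⟨⟨hak, hkb⟩, hk, hxk⟩ hb
    have hh : hi.eval s' = b := hhi k s' hak hkb hk hxk
    simp only [BExp.holds, NExp.eval, hxk, hh] at hb
    obtain rfl : k = b := by lia
    exact le_rfl
  · exact ⟨⟨le_rfl, hab⟩, hI, by simp⟩
  · simp only [BExp.cost, NExp.cost]; lia

/-- `for x = lo, …, hi - 1 do y := y + h`. -/
def sumLoop (x y : ℕ) (lo hi : NExp) (h : RExp) : Cmd :=
  forLoop x lo hi (.rset y (.add (.var y) h))

theorem runs_sumLoop {x y : ℕ} {lo hi : NExp} {h : RExp} {s : Store} {a b : ℕ} {f : ℕ → ℝ}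
    (hlo : lo.eval s = a) (hab : a ≤ b)
    (hhi : ∀ k v, hi.eval ((s.setN x k).setR y v) = b)
    (hf : ∀ k v, a ≤ k → k < b → h.eval ((s.setN x k).setR y v) = f k) {U : ℕ}
    (hU : (b - a) * (h.cost + hi.cost + 10) + lo.cost + hi.cost + 4 ≤ U) :
    Runs (sumLoop x y lo hi h) s U fun s' =>
      s' = (s.setN x b).setR y (s.rvar y + ∑ k ∈ Finset.Ico a b, f k) := by
  have H := runs_forLoop (x := x) (lo := lo) (hi := hi) (c := .rset y (.add (.var y) h))
    (I := fun k s' => s' = (s.setN x k).setR y (s.rvar y + ∑ k ∈ Finset.Ico a k, f k))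
    (T := fun k => (k - a) * (h.cost + hi.cost + 10)) (a := a) (b := b) (s := s) (U := U)
    (by simp [Cmd.modN]) hlo hab ?_ ?_ ?_ (by simpa using hU)
  · exact H.mono le_rfl fun _ h => h.1
  · simp [Store.setN, Store.setR]
  · rintro k _ - - rfl -
    exact hhi _ _
  · rintro k _ hak hkb rfl -
    refine ⟨h.cost + 3, ?_, (Runs.rset _ _ _).mono (by simp [RExp.cost]; lia) ?_⟩
    · rw [Nat.sub_add_comm hak, Nat.succ_mul]; lia
    · rintro _ rfl
      simp only [RExp.eval, hf _ _ hak hkb, Finset.sum_Ico_succ_top hak]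
      simp [Store.setN, Store.setR, add_assoc]

/-- `for x = 0, …, hi - 1 do A[B + x] := h`, where the cell `A[B]` is given by the array `A` and the
offset `B`. -/
def mapLoop (x A : ℕ) (B hi : NExp) (h : RExp) : Cmd :=
  forLoop x (.const 0) hi (.rput A (.add B (.var x)) h)

/-- In `hf` the array may be assumed unchanged outside the cells already written. This allows
updates in place, where the new value of a cell depends on its old one. -/
theorem runs_mapLoop {x A : ℕ} {B hi : NExp} {h : RExp} {s : Store} {b o : ℕ} {f : ℕ → ℝ}
    (hB : ∀ k g, B.eval ((s.setN x k).setA A g) = o)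
    (hhi : ∀ k g, hi.eval ((s.setN x k).setA A g) = b)
    (hf : ∀ k g, k < b → (∀ m, m < o ∨ o + k ≤ m → g m = s.rarr A m) →
      h.eval ((s.setN x k).setA A g) = f k) {U : ℕ}
    (hU : b * (B.cost + h.cost + hi.cost + 10) + hi.cost + 5 ≤ U) :
    Runs (mapLoop x A B hi h) s U fun s' =>
      s' = (s.setN x b).setA A fun m => if o ≤ m ∧ m < o + b then f (m - o) else s.rarr A m := by
  have H := runs_forLoop (x := x) (lo := .const 0) (hi := hi) (c := .rput A (.add B (.var x)) h)
    (I := fun k s' => s' = (s.setN x k).setA A fun m =>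
      if o ≤ m ∧ m < o + k then f (m - o) else s.rarr A m)
    (T := fun k => k * (B.cost + h.cost + hi.cost + 10)) (a := 0) (b := b) (s := s) (U := U)
    (by simp [Cmd.modN]) rfl b.zero_le ?_ ?_ ?_ (by simpa [NExp.cost, add_right_comm] using hU)
  · exact H.mono le_rfl fun _ h => h.1
  · have : ∀ m, ¬ (o ≤ m ∧ m < o + 0) := fun m => by lia
    simp only [this, if_false]
    simp [Store.setN, Store.setA]
  · rintro k _ - - rfl -
    exact hhi _ _
  · rintro k _ - hkb rfl -
    refine ⟨B.cost + h.cost + 3, by lia,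
      (Runs.rput _ _ _ _).mono (by simp [NExp.cost]; lia) ?_⟩
    rintro _ rfl
    simp only [NExp.eval, hB]
    rw [hf _ _ hkb fun m hm => by rw [if_neg (by lia)]]
    simp only [Store.setN, Store.setA, Store.putR, Function.update_idem, Function.update_self]
    congr 2
    funext m
    simp only [Function.update_apply]
    by_cases hm : m = o + k
    · simp [hm]
    · rw [if_neg hm]
      have : (o ≤ m ∧ m < o + k) ↔ (o ≤ m ∧ m < o + (k + 1)) := by lia
      simp only [this]

/-- `for x = lo, …, hi - 1 do A[i] := A[i] - h`. -/
def scatterLoop (x A : ℕ) (lo hi : NExp) (i : NExp) (h : RExp) : Cmd :=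
  forLoop x lo hi (.rput A i (.sub (.get A i) h))

/-- The target positions `p k` need not be distinct or ordered: the final content of a cell collects
every entry aimed at it. -/
theorem runs_scatterLoop {x A : ℕ} {lo hi i : NExp} {h : RExp} {s : Store} {a b : ℕ} {f : ℕ → ℝ}
    {p : ℕ → ℕ} (hlo : lo.eval s = a) (hab : a ≤ b)
    (hhi : ∀ k g, hi.eval ((s.setN x k).setA A g) = b)
    (hp : ∀ k g, a ≤ k → k < b → i.eval ((s.setN x k).setA A g) = p k)
    (hf : ∀ k g, a ≤ k → k < b → h.eval ((s.setN x k).setA A g) = f k) {U : ℕ}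
    (hU : (b - a) * (2 * i.cost + h.cost + hi.cost + 10) + lo.cost + hi.cost + 4 ≤ U) :
    Runs (scatterLoop x A lo hi i h) s U fun s' =>
      s' = (s.setN x b).setA A fun m =>
        s.rarr A m - ∑ k ∈ Finset.Ico a b, if p k = m then f k else 0 := by
  have H := runs_forLoop (x := x) (lo := lo) (hi := hi) (c := .rput A i (.sub (.get A i) h))
    (I := fun k s' => s' = (s.setN x k).setA A fun m =>
      s.rarr A m - ∑ k ∈ Finset.Ico a k, if p k = m then f k else 0)
    (T := fun k => (k - a) * (2 * i.cost + h.cost + hi.cost + 10)) (a := a) (b := b) (s := s)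
    (U := U) (by simp [Cmd.modN]) hlo hab ?_ ?_ ?_ (by simpa using hU)
  · exact H.mono le_rfl fun _ h => h.1
  · simp [Store.setN, Store.setA]
  · rintro k _ - - rfl -
    exact hhi _ _
  · rintro k _ hak hkb rfl -
    refine ⟨2 * i.cost + h.cost + 3, ?_,
      (Runs.rput _ _ _ _).mono (by simp [RExp.cost]; lia) ?_⟩
    · rw [Nat.sub_add_comm hak, Nat.succ_mul]; lia
    · rintro _ rfl
      simp only [RExp.eval, hf _ _ hak hkb, hp _ _ hak hkb, Finset.sum_Ico_succ_top hak]
      simp only [Store.setN, Store.setA, Store.putR, Function.update_idem, Function.update_self]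
      congr 2
      funext m
      simp only [Function.update_apply]
      by_cases hm : m = p k
      · simp [hm]; ring
      · rw [if_neg hm, if_neg (Ne.symm hm), add_zero]

end RealRAM

/-! ### The stored input and the scan for a maximizing point -/

namespace SIB

open RealRAM

/-- The first `d` cells of an array as a vector. -/
def vec (d : ℕ) (f : ℕ → ℝ) : EuclideanSpace ℝ (Fin d) := WithLp.toLp 2 fun j : Fin d => f j

@[simp] theorem vec_apply {d : ℕ} (f : ℕ → ℝ) (j : Fin d) : vec d f j = f j := rfl

theorem inner_vec {d : ℕ} (f : ℕ → ℝ) (v : EuclideanSpace ℝ (Fin d)) :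
    inner ℝ (vec d f) v = ∑ j : Fin d, v j * f j := by
  simp [PiLp.inner_apply]

theorem norm_vec_sq {d : ℕ} (f : ℕ → ℝ) :
    ‖vec d f‖ ^ 2 = ∑ j ∈ Finset.Ico 0 d, f j * f j := by
  rw [EuclideanSpace.norm_sq_eq, ← Finset.range_eq_Ico, ← Fin.sum_univ_eq_sum_range]
  simp [sq]

/-- Row `k` of the matrix with `d` columns that is stored in real array `2`. -/
def row (d : ℕ) (s : Store) (k : ℕ) : EuclideanSpace ℝ (Fin d) :=
  vec d fun j => s.rarr 2 (k * d + j)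

/-- The points `q t` are stored in compressed sparse row format. -/
structure Layout {d : ℕ} (n : ℕ) (q : ℕ → EuclideanSpace ℝ (Fin d)) (s : Store) : Prop where
  nvar_zero : s.nvar 0 = n
  nvar_one : s.nvar 1 = d
  group_zero : s.narr 0 0 = 0
  group_lt : ∀ i < n, s.narr 0 i < s.narr 0 (i + 1)
  point_zero : s.narr 1 0 = 0
  point_le : ∀ t < s.narr 0 n, s.narr 1 t ≤ s.narr 1 (t + 1)
  index_lt : ∀ t < s.narr 0 n, ∀ e ∈ Ico (s.narr 1 t) (s.narr 1 (t + 1)), s.narr 2 e < d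
  sum_entries : ∀ t < s.narr 0 n, ∀ F : ℕ → ℝ → ℝ, (∀ j, F j 0 = 0) →
    ∑ e ∈ Finset.Ico (s.narr 1 t) (s.narr 1 (t + 1)), F (s.narr 2 e) (s.rarr 0 e) =
      ∑ j : Fin d, F j (q t j)

/-- Two memories that contain the same input. -/
abbrev SameInput : Store → Store → Prop :=
  Agree [2, 3, 4, 5, 6, 7, 8, 9, 10] [1, 2, 3, 4, 5, 6, 7] [] [1, 2, 3, 4, 5]

namespace Layout

variable {n d : ℕ} {q : ℕ → EuclideanSpace ℝ (Fin d)} {s s' : Store}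

theorem of_agree (h : Layout n q s) (hs : SameInput s s') : Layout n q s' := by
  have h0 := hs.nvar 0 (by decide)
  have h1 := hs.nvar 1 (by decide)
  have h2 := hs.narr 0 (by decide)
  have h3 := hs.narr 1 (by decide)
  have h4 := hs.narr 2 (by decide)
  have h5 := hs.rarr 0 (by decide)
  obtain ⟨a1, a2, a3, a4, a5, a6, a7, a8⟩ := h
  constructor <;> simp only [h0, h1, h2, h3, h4, h5] <;> assumption

theorem group_mono (h : Layout n q s) {i j : ℕ} (hij : i ≤ j) (hj : j ≤ n) :
    s.narr 0 i ≤ s.narr 0 j := by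
  induction j, hij using Nat.le_induction with
  | base => exact le_rfl
  | succ j hij ih => exact (ih (by lia)).trans (h.group_lt j (by lia)).le

theorem point_mono (h : Layout n q s) {i j : ℕ} (hij : i ≤ j) (hj : j ≤ s.narr 0 n) :
    s.narr 1 i ≤ s.narr 1 j := by
  induction j, hij using Nat.le_induction with
  | base => exact le_rfl
  | succ j hij ih => exact (ih (by lia)).trans (h.point_le j (by lia))

end Layout

/-- `for p = lo, …, hi - 1`: compute the sum of `init` and of `h` over all entries of point `p`, and
put a point with the largest sum into natural variable `8`, and this sum into real variable `5`. -/
def argmaxLoop (lo hi : NExp) (init h : RExp) : Cmd :=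
  forLoop 6 lo hi <| .seq (.rset 4 init) <|
    .seq (sumLoop 7 4 (.get 1 (.var 6)) (.get 1 (.add (.var 6) (.const 1))) h) <|
    .ite (.neg (.conj (.nlt lo (.var 6)) (.neg (.rlt (.var 5) (.var 4)))))
      (.seq (.nset 8 (.var 6)) (.rset 5 (.var 4))) .skip

/-- The record holds arbitrary values beforehand, so the test in `argmaxLoop` accepts the first
point unconditionally and later points only on strict improvement. The time is proportional to the
number of entries plus the number of points scanned. -/
theorem runs_argmaxLoop {lo hi : NExp} {init h : RExp} {s : Store} {a b : ℕ} {c : ℝ} {f : ℕ → ℝ}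
    (hab : a < b) (hmono : ∀ p, a ≤ p → p < b → s.narr 1 p ≤ s.narr 1 (p + 1))
    (hlo : ∀ s', Agree [6, 7, 8] [4, 5] [] [] s s' → lo.eval s' = a)
    (hhi : ∀ s', Agree [6, 7, 8] [4, 5] [] [] s s' → hi.eval s' = b)
    (hinit : ∀ s', Agree [6, 7, 8] [4, 5] [] [] s s' → init.eval s' = c)
    (hf : ∀ s', Agree [6, 7, 8] [4, 5] [] [] s s' → h.eval s' = f (s'.nvar 7)) {U : ℕ}
    (hU : (s.narr 1 b - s.narr 1 a) * (h.cost + 14) +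
      (b - a) * (init.cost + 2 * lo.cost + hi.cost + 50) + lo.cost + hi.cost + 4 ≤ U) :
    Runs (argmaxLoop lo hi init h) s U fun s' =>
      (a ≤ s'.nvar 8 ∧ s'.nvar 8 < b) ∧
      s'.rvar 5 = c + ∑ e ∈ Finset.Ico (s.narr 1 (s'.nvar 8)) (s.narr 1 (s'.nvar 8 + 1)), f e ∧
      ∀ p, a ≤ p → p < b →
        c + ∑ e ∈ Finset.Ico (s.narr 1 p) (s.narr 1 (p + 1)), f e ≤ s'.rvar 5 := by
  set φ : ℕ → ℝ := fun p => c + ∑ e ∈ Finset.Ico (s.narr 1 p) (s.narr 1 (p + 1)), f e with hφ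
  have hmono' : ∀ p, a ≤ p → p ≤ b → s.narr 1 a ≤ s.narr 1 p := by
    intro p hap
    induction p, hap using Nat.le_induction with
    | base => exact fun _ => le_rfl
    | succ p hap ih => exact fun hp => (ih (by lia)).trans (hmono p hap (by lia))
  have H := runs_forLoop (x := 6) (lo := lo) (hi := hi) (c := .seq (.rset 4 init) <|
    .seq (sumLoop 7 4 (.get 1 (.var 6)) (.get 1 (.add (.var 6) (.const 1))) h) <|
    .ite (.neg (.conj (.nlt lo (.var 6)) (.neg (.rlt (.var 5) (.var 4)))))
      (.seq (.nset 8 (.var 6)) (.rset 5 (.var 4))) .skip)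
    (I := fun k s' => Agree [6, 7, 8] [4, 5] [] [] s s' ∧ (a < k →
      (a ≤ s'.nvar 8 ∧ s'.nvar 8 < k) ∧ s'.rvar 5 = φ (s'.nvar 8) ∧
      ∀ p, a ≤ p → p < k → φ p ≤ s'.rvar 5))
    -- Array `1` holds prefix sums of the entry counts, so using it in the time function makes the
    -- cost of the inner loops telescope.
    (T := fun k => s.narr 1 k * (h.cost + 14) + k * (init.cost + 2 * lo.cost + hi.cost + 50))
    (a := a) (b := b) (s := s) (U := U)
    (by simp [Cmd.modN, sumLoop, forLoop]) (hlo s (.refl _ _ _ _ s)) hab.le ?_ ?_ ?_ ?_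
  · refine H.mono le_rfl ?_
    rintro s' ⟨⟨-, h⟩, -⟩
    exact h hab
  · refine ⟨?_, fun h => absurd h (lt_irrefl _)⟩
    refine ⟨fun x hx => ?_, fun _ _ => rfl, fun _ _ => rfl, fun _ _ => rfl⟩
    have : x ≠ 6 := by rintro rfl; exact hx (by decide)
    simp [this]
  · exact fun k s' _ _ hI _ => hhi s' hI.1
  · rintro k s' hak hkb ⟨hag, hI⟩ hk
    have hn1 : s'.narr 1 = s.narr 1 := hag.narr 1 (by decide)
    refine ⟨(init.cost + 1) + (((s.narr 1 (k + 1) - s.narr 1 k) * (h.cost + 14) + 10) +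
      (lo.cost + 20)), ?_, ?_⟩
    · have h1 := hmono k hak hkb
      obtain ⟨m, hm⟩ := Nat.exists_eq_add_of_le h1
      simp only [hm, Nat.add_sub_cancel_left, Nat.add_mul]
      lia
    · refine (Runs.rset s' 4 init).seq ?_
      rintro s1 rfl
      rw [hinit s' hag]
      have hag1 : ∀ k v, Agree [6, 7, 8] [4, 5] [] [] s (((s'.setR 4 c).setN 7 k).setR 4 v) := by
        refine fun k v => hag.trans ⟨fun x hx => ?_, fun x hx => ?_, fun _ _ => rfl, fun _ _ => rfl⟩
        · have : x ≠ 7 := by rintro rfl; exact hx (by decide)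
          simp [this]
        · have : x ≠ 4 := by rintro rfl; exact hx (by decide)
          simp [this]
      refine (runs_sumLoop (a := s.narr 1 k) (b := s.narr 1 (k + 1)) (f := f) ?_ (hmono k hak hkb)
        ?_ ?_ ?_).seq ?_
      · simp [NExp.eval, hk, hn1]
      · intro j v
        simp [NExp.eval, hk, hn1]
      · intro j v _ _
        rw [hf _ (hag1 j v)]
        simp
      · simp only [NExp.cost]
        apply le_of_eq
        ring
      rintro s2 rfl
      have hφk : (s'.setR 4 c).rvar 4 +
          ∑ e ∈ Finset.Ico (s.narr 1 k) (s.narr 1 (k + 1)), f e = φ k := by simp [hφ]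
      rw [hφk]
      have hag2 := hag1 (s.narr 1 (k + 1)) (φ k)
      refine (Runs.ite (T := 4) (Q := fun s'' =>
        Agree [6, 7, 8] [4, 5] [] [] s (s''.setN 6 (k + 1)) ∧ (a < k + 1 →
          (a ≤ (s''.setN 6 (k + 1)).nvar 8 ∧ (s''.setN 6 (k + 1)).nvar 8 < k + 1) ∧
          (s''.setN 6 (k + 1)).rvar 5 = φ ((s''.setN 6 (k + 1)).nvar 8) ∧
          ∀ p, a ≤ p → p < k + 1 → φ p ≤ (s''.setN 6 (k + 1)).rvar 5)) ?_ ?_).mono ?_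
          fun _ h => h
      · intro hb
        simp only [BExp.holds, NExp.eval, RExp.eval, hlo _ hag2] at hb
        simp [hk] at hb
        refine ((Runs.nset _ _ _).seq (T := 2) (T' := 2) fun s3 hs3 => (Runs.rset _ _ _).mono
          (by simp [RExp.cost]) ?_)
        subst hs3
        rintro _ rfl
        refine ⟨hag2.trans ⟨fun x hx => ?_, fun x hx => ?_, fun _ _ => rfl, fun _ _ => rfl⟩,
          fun _ => ⟨?_, ?_, ?_⟩⟩
        · have : x ≠ 6 := by rintro rfl; exact hx (by decide)
          have : x ≠ 8 := by rintro rfl; exact hx (by decide)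
          simp [*]
        · have : x ≠ 5 := by rintro rfl; exact hx (by decide)
          simp [this]
        · simp [NExp.eval, hk, hak]
        · simp [NExp.eval, RExp.eval, hk]
        · intro p hap hpk
          simp only [RExp.eval, NExp.eval, Store.rvar_setN, Store.rvar_setR, if_true]
          rcases Nat.lt_succ_iff_lt_or_eq.1 hpk with hlt | rfl
          · have hak' : a < k := by lia
            exact ((hI hak').2.2 p hap hlt).trans (hb hak').le
          · exact le_rfl
      · intro hb
        simp only [BExp.holds, NExp.eval, RExp.eval, hlo _ hag2] at hb
        simp [hk] at hb
        refine (Runs.skip _).mono (by lia) ?_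
        rintro _ rfl
        obtain ⟨h1, h2, h3⟩ := hI hb.1
        refine ⟨hag2.trans ⟨fun x hx => ?_, fun x hx => rfl, fun _ _ => rfl, fun _ _ => rfl⟩,
          fun _ => ⟨?_, ?_, ?_⟩⟩
        · have : x ≠ 6 := by rintro rfl; exact hx (by decide)
          simp [this]
        · simp; lia
        · simpa using h2
        · intro p hap hpk
          simp only [Store.rvar_setN, Store.rvar_setR]
          rcases Nat.lt_succ_iff_lt_or_eq.1 hpk with hlt | rfl
          · simpa using h3 p hap hlt
          · simpa using hb.2
      · simp only [BExp.cost, NExp.cost, RExp.cost]; lia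
  · have h1 := hmono' b hab.le le_rfl
    obtain ⟨m, hm⟩ := Nat.exists_eq_add_of_le h1
    obtain ⟨m', hm'⟩ := Nat.exists_eq_add_of_le hab.le
    rw [hm, Nat.add_sub_cancel_left, show b - a = m' by lia] at hU
    rw [hm, Nat.add_mul, show b * (init.cost + 2 * lo.cost + hi.cost + 50) =
      a * (init.cost + 2 * lo.cost + hi.cost + 50) +
      m' * (init.cost + 2 * lo.cost + hi.cost + 50) by rw [hm', Nat.add_mul]]
    lia

end SIB

/-! ### One group within a round: choose a point, update the gain, weigh it -/

namespace SIB

open RealRAM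

theorem row_disjoint {d i k j : ℕ} (hik : k ≠ i) (hj : j < d) :
    ¬ (i * d ≤ k * d + j ∧ k * d + j < i * d + d) := by
  rintro ⟨h1, h2⟩
  rcases Nat.lt_or_gt_of_ne hik with h | h
  · have := Nat.mul_le_mul_right d (Nat.succ_le_of_lt h)
    rw [Nat.succ_mul] at this
    lia
  · have := Nat.mul_le_mul_right d (Nat.succ_le_of_lt h)
    rw [Nat.succ_mul] at this
    lia

/-- Find a point of group `i` (natural variable `3`) that maximizes the inner product with row `i` of
the matrix. -/
def pickCmd : Cmd :=
  argmaxLoop (.get 0 (.var 3)) (.get 0 (.add (.var 3) (.const 1))) (.ofNat (.const 0))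
    (.mul (.get 0 (.var 7)) (.get 2 (.add (.var 4) (.get 2 (.var 7)))))

variable {n d : ℕ} {q : ℕ → EuclideanSpace ℝ (Fin d)} {s : Store}

/-- `Layout.sum_entries` is applied with a summand that vanishes at coordinate value zero, which
turns the scan over stored entries into the full inner product. The offset `i * d` is supplied in a
variable because naturals cannot be multiplied. -/
theorem runs_pickCmd (h : Layout n q s) {i : ℕ} (hi : i < n) (h3 : s.nvar 3 = i)
    (h4 : s.nvar 4 = i * d) :
    Runs pickCmd s (22 * (s.narr 1 (s.narr 0 (i + 1)) - s.narr 1 (s.narr 0 i)) +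
      64 * (s.narr 0 (i + 1) - s.narr 0 i) + 10) fun s' =>
      (s.narr 0 i ≤ s'.nvar 8 ∧ s'.nvar 8 < s.narr 0 (i + 1)) ∧
      ∀ p, s.narr 0 i ≤ p → p < s.narr 0 (i + 1) →
        inner ℝ (row d s i) (q p) ≤ inner ℝ (row d s i) (q (s'.nvar 8)) := by
  have hM : ∀ p, p < s.narr 0 (i + 1) → p < s.narr 0 n := fun p hp =>
    hp.trans_le (h.group_mono (by lia) le_rfl)
  have hφ : ∀ p, p < s.narr 0 (i + 1) →
      (0 : ℝ) + ∑ e ∈ Finset.Ico (s.narr 1 p) (s.narr 1 (p + 1)),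
        s.rarr 0 e * s.rarr 2 (i * d + s.narr 2 e) = inner ℝ (row d s i) (q p) := by
    intro p hp
    rw [zero_add, h.sum_entries p (hM p hp) (fun j x => x * s.rarr 2 (i * d + j)) (by simp), row,
      inner_vec]
  refine (runs_argmaxLoop (a := s.narr 0 i) (b := s.narr 0 (i + 1)) (c := 0)
    (f := fun e => s.rarr 0 e * s.rarr 2 (i * d + s.narr 2 e)) (h.group_lt i hi)
    (fun p _ hp => h.point_le p (hM p hp)) ?_ ?_ ?_ ?_ ?_).mono le_rfl ?_
  · intro s' hs
    simp [NExp.eval, hs.nvar 3 (by decide), hs.narr 0 (by decide), h3]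
  · intro s' hs
    simp [NExp.eval, hs.nvar 3 (by decide), hs.narr 0 (by decide), h3]
  · intro s' hs
    simp [NExp.eval, RExp.eval]
  · intro s' hs
    simp [NExp.eval, RExp.eval, hs.nvar 4 (by decide), hs.narr 2 (by decide),
      hs.rarr 0 (by decide), hs.rarr 2 (by decide), h4]
  · simp only [NExp.cost, RExp.cost]; lia
  · rintro s' ⟨⟨h1, h2⟩, h5, h6⟩
    refine ⟨⟨h1, h2⟩, fun p hp1 hp2 => ?_⟩
    rw [← hφ p hp2, ← hφ _ h2, ← h5]
    exact h6 p hp1 hp2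

/-- Add the vector in real array `5` to row `i` of the matrix and subtract the point whose number is
in natural variable `8`. -/
def moveCmd : Cmd :=
  .seq (mapLoop 5 2 (.var 4) (.var 1)
      (.add (.get 2 (.add (.var 4) (.var 5))) (.get 5 (.var 5))))
    (scatterLoop 7 2 (.get 1 (.var 8)) (.get 1 (.add (.var 8) (.const 1)))
      (.add (.var 4) (.get 2 (.var 7))) (.get 0 (.var 7)))

theorem Layout.sum_entries_single (h : Layout n q s) {p : ℕ} (hp : p < s.narr 0 n) (j : Fin d) :
    ∑ e ∈ Finset.Ico (s.narr 1 p) (s.narr 1 (p + 1)),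
      (if s.narr 2 e = j then s.rarr 0 e else 0) = q p j := by
  rw [h.sum_entries p hp (fun k x => if k = j then x else 0) (by simp)]
  simp [Fin.val_inj]

/-- The center is added densely and the point is subtracted sparsely. Other rows survive because all
written positions lie in the block of row `i`, by `index_lt` and `row_disjoint`. -/
theorem runs_moveCmd (h : Layout n q s) {i p : ℕ} (h4 : s.nvar 4 = i * d) (h8 : s.nvar 8 = p)
    (hp : p < s.narr 0 n) :
    Runs moveCmd s (25 * d + 24 * (s.narr 1 (p + 1) - s.narr 1 p) + 20) fun s' =>
      row d s' i = row d s i + (vec d (s.rarr 5) - q p) ∧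
      ∀ k ≠ i, row d s' k = row d s k := by
  refine ((runs_mapLoop (s := s) (b := d) (o := i * d)
    (f := fun j => s.rarr 2 (i * d + j) + s.rarr 5 j) (U := 25 * d + 6)
    ?_ ?_ ?_ ?_).seq (T' := 24 * (s.narr 1 (p + 1) - s.narr 1 p) + 14) ?_).mono
    (by lia) fun _ h => h
  · simp [NExp.eval, h4]
  · simp [NExp.eval, h.nvar_one]
  · intro k g hk hg
    simp [RExp.eval, NExp.eval, h4, hg (i * d + k) (Or.inr le_rfl)]
  · simp only [NExp.cost, RExp.cost]; lia
  rintro _ rfl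
  refine (runs_scatterLoop (a := s.narr 1 p) (b := s.narr 1 (p + 1)) (f := s.rarr 0)
    (p := fun e => i * d + s.narr 2 e) ?_ (h.point_le p hp) ?_ ?_ ?_ ?_).mono le_rfl ?_
  · simp [NExp.eval, h8]
  · simp [NExp.eval, h8]
  · simp [NExp.eval, h4]
  · simp [RExp.eval, NExp.eval]
  · simp only [NExp.cost, RExp.cost]; lia
  rintro _ rfl
  constructor
  · ext j
    have hj := j.2
    simp [row, hj, h.sum_entries_single hp j]
    ring
  · intro k hk
    ext j
    have hd := row_disjoint hk j.2
    have hz : ∑ e ∈ Finset.Ico (s.narr 1 p) (s.narr 1 (p + 1)),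
        (if i * d + s.narr 2 e = k * d + j then s.rarr 0 e else 0) = 0 := by
      refine Finset.sum_eq_zero fun e he => if_neg fun heq => hd ?_
      have := h.index_lt p hp e (by simpa using he)
      lia
    simp only [row, vec_apply, Store.rarr_setA, if_true, hz, if_neg hd, sub_zero]

/-- Compute the norm of row `i`, update the maximal norm (real variable `1`), add the weighted row to
the vector in real array `3`, and advance the offset. -/
def weighCmd : Cmd :=
  .seq (.rset 4 (.ofNat (.const 0))) <|
  .seq (sumLoop 5 4 (.const 0) (.var 1)
    (.mul (.get 2 (.add (.var 4) (.var 5))) (.get 2 (.add (.var 4) (.var 5))))) <|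
  .seq (.rset 4 (.sqrt (.var 4))) <|
  .seq (.ite (.rlt (.var 1) (.var 4)) (.rset 1 (.var 4)) .skip) <|
  .seq (.rset 6 (.div (.sub (.exp (.mul (.var 3) (.var 4)))
      (.exp (.sub (.ofNat (.const 0)) (.mul (.var 3) (.var 4))))) (.add (.var 4) (.var 4)))) <|
  .seq (mapLoop 5 3 (.const 0) (.var 1)
    (.add (.get 3 (.var 5)) (.mul (.var 6) (.get 2 (.add (.var 4) (.var 5)))))) <|
  .nset 4 (.add (.var 4) (.var 1))

/-- The weighted vector `(sinh (η ‖v‖) / ‖v‖) v`. -/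
noncomputable def weighted {E : Type*} [NormedAddCommGroup E] [InnerProductSpace ℝ E] (η : ℝ)
    (v : E) : E := (Real.sinh (η * ‖v‖) / ‖v‖) • v

/-- The weight is computed as `(exp x - exp (-x)) / (2 ‖v‖)` with `x = η ‖v‖`; for a zero row the
quotient is zero, as in `weighted`. The offset moves to the next row by adding `d`. -/
theorem runs_weighCmd (h : Layout n q s) {i : ℕ} (h4 : s.nvar 4 = i * d) :
    Runs weighCmd s (50 * d + 60) fun s' =>
      s'.rvar 1 = max (s.rvar 1) ‖row d s i‖ ∧
      vec d (s'.rarr 3) = vec d (s.rarr 3) + weighted (s.rvar 3) (row d s i) ∧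
      s'.nvar 4 = (i + 1) * d := by
  have h1 := h.nvar_one
  have hnorm : √(∑ k ∈ Finset.range d, s.rarr 2 (i * d + k) * s.rarr 2 (i * d + k)) =
      ‖row d s i‖ := by
    rw [Finset.range_eq_Ico, ← norm_vec_sq (d := d) fun k => s.rarr 2 (i * d + k),
      Real.sqrt_sq (norm_nonneg _), row]
  refine ((Runs.rset s 4 _).seq (T := 3) (T' := 50 * d + 57) ?_).mono (by lia) fun _ h => h
  rintro _ rfl
  refine ((runs_sumLoop (a := 0) (b := d) (U := 22 * d + 6)
    (f := fun j => s.rarr 2 (i * d + j) * s.rarr 2 (i * d + j)) rfl d.zero_le ?_ ?_ ?_).seq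
    (T' := 28 * d + 51) ?_).mono (by lia) fun _ h => h
  · simp [NExp.eval, h1]
  · simp [NExp.eval, RExp.eval, h4]
  · simp only [NExp.cost, RExp.cost]; lia
  rintro _ rfl
  refine ((Runs.rset _ 4 _).seq (T := 3) (T' := 28 * d + 48) ?_).mono (by lia) fun _ h => h
  rintro _ rfl
  simp only [RExp.eval, NExp.eval, Nat.cast_zero, Store.rvar_setR, Store.rvar_setN, if_true,
    zero_add, Nat.Ico_zero_eq_range, hnorm]
  set s1 := (((s.setR 4 0).setN 5 d).setR 4
    (∑ k ∈ Finset.range d, s.rarr 2 (i * d + k) * s.rarr 2 (i * d + k))).setR 4 ‖row d s i‖ with hs1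
  refine ((Runs.ite (T := 2) (Q := fun s' => s' = s1.setR 1 (max (s.rvar 1) ‖row d s i‖))
    ?_ ?_).seq (T := 6) (T' := 28 * d + 42) ?_).mono (by lia) fun _ h => h
  · intro hb
    simp only [BExp.holds, RExp.eval] at hb
    refine (Runs.rset _ 1 _).mono (by simp [RExp.cost]) ?_
    rintro _ rfl
    have h14 : s1.rvar 4 = ‖row d s i‖ := by simp [hs1]
    have h11 : s1.rvar 1 = s.rvar 1 := by simp [hs1]
    rw [h14, h11] at hb
    simp only [RExp.eval, h14]
    rw [max_eq_right hb.le]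
  · intro hb
    simp only [BExp.holds, RExp.eval] at hb
    refine (Runs.skip _).mono (by lia) ?_
    rintro _ rfl
    have h14 : s1.rvar 4 = ‖row d s i‖ := by simp [hs1]
    have h11 : s1.rvar 1 = s.rvar 1 := by simp [hs1]
    rw [h14, h11] at hb
    rw [max_eq_left (not_lt.1 hb), ← h11]
    simp [Store.setR]
  rintro _ rfl
  refine ((Runs.rset _ 6 _).seq (T := 17) (T' := 28 * d + 25) ?_).mono (by lia) fun _ h => h
  rintro _ rfl
  have hw : RExp.eval (s1.setR 1 (max (s.rvar 1) ‖row d s i‖))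
      (.div (.sub (.exp (.mul (.var 3) (.var 4)))
        (.exp (.sub (.ofNat (.const 0)) (.mul (.var 3) (.var 4))))) (.add (.var 4) (.var 4))) =
      Real.sinh (s.rvar 3 * ‖row d s i‖) / ‖row d s i‖ := by
    simp only [RExp.eval, NExp.eval, hs1, Store.rvar_setR, Store.rvar_setN]
    norm_num
    rw [Real.sinh_eq, div_div, two_mul]
  rw [hw]
  refine ((runs_mapLoop (b := d) (o := 0) (U := 22 * d + 6)
    (f := fun j => s.rarr 3 j + Real.sinh (s.rvar 3 * ‖row d s i‖) / ‖row d s i‖ *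
      s.rarr 2 (i * d + j)) ?_ ?_ ?_ ?_).seq (T' := 4) ?_).mono (by lia) fun _ h => h
  · simp [NExp.eval]
  · simp [NExp.eval, hs1, h1]
  · intro k g hk hg
    simp [NExp.eval, RExp.eval, hs1, h4, hg k (by lia)]
  · simp only [NExp.cost, RExp.cost]; lia
  rintro _ rfl
  refine (Runs.nset _ _ _).mono (by simp [NExp.cost]) ?_
  rintro _ rfl
  refine ⟨?_, ?_, ?_⟩
  · simp [hs1]
  · ext j
    simp [weighted, row]
  · simp [NExp.eval, hs1, h4, h1, Nat.succ_mul]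

/-- One round for one group. -/
def groupCmd : Cmd := .seq pickCmd (.seq moveCmd weighCmd)

/-- The point is chosen by the old row, whereas norm and weight use the new one: one pass finishes
the current round and prepares the weights of the next. -/
theorem runs_groupCmd (h : Layout n q s) {i : ℕ} (hi : i < n) (h3 : s.nvar 3 = i)
    (h4 : s.nvar 4 = i * d) :
    Runs groupCmd s (46 * (s.narr 1 (s.narr 0 (i + 1)) - s.narr 1 (s.narr 0 i)) +
      64 * (s.narr 0 (i + 1) - s.narr 0 i) + 75 * d + 90) fun s' =>
      (∃ p, (s.narr 0 i ≤ p ∧ p < s.narr 0 (i + 1)) ∧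
        (∀ p', s.narr 0 i ≤ p' → p' < s.narr 0 (i + 1) →
          inner ℝ (row d s i) (q p') ≤ inner ℝ (row d s i) (q p)) ∧
        row d s' i = row d s i + (vec d (s.rarr 5) - q p)) ∧
      (∀ k ≠ i, row d s' k = row d s k) ∧
      s'.rvar 1 = max (s.rvar 1) ‖row d s' i‖ ∧
      vec d (s'.rarr 3) = vec d (s.rarr 3) + weighted (s.rvar 3) (row d s' i) ∧
      s'.nvar 4 = (i + 1) * d := by
  refine (((runs_pickCmd h hi h3 h4).frame le_rfl fun s1 hag hs1 => And.intro hag hs1).seq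
    (T' := 24 * (s.narr 1 (s.narr 0 (i + 1)) - s.narr 1 (s.narr 0 i)) + 75 * d + 80) ?_).mono
    (by lia) fun _ h => h
  rintro s1 ⟨hag1, ⟨hp1, hp2⟩, hmax⟩
  have hi1 : SameInput s s1 := hag1.mono (by decide) (by decide) (by decide) (by decide)
  have hL1 := h.of_agree hi1
  have hn0 : s1.narr 0 = s.narr 0 := hag1.narr 0 (by decide)
  have hn1 : s1.narr 1 = s.narr 1 := hag1.narr 1 (by decide)
  have hr2 : s1.rarr 2 = s.rarr 2 := hag1.rarr 2 (by decide)
  have hrow1 : ∀ k, row d s1 k = row d s k := fun k => by rw [row, row, hr2]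
  have hpn : s1.nvar 8 < s1.narr 0 n := by
    rw [hn0]; exact hp2.trans_le (h.group_mono (by lia) le_rfl)
  have hmono1 : s.narr 1 (s.narr 0 i) ≤ s.narr 1 (s1.nvar 8) :=
    h.point_mono hp1 (by rw [hn0] at hpn; exact hpn.le)
  have hmono2 : s.narr 1 (s1.nvar 8 + 1) ≤ s.narr 1 (s.narr 0 (i + 1)) :=
    h.point_mono hp2 (h.group_mono (by lia) le_rfl)
  refine (((runs_moveCmd hL1 (i := i) ((hag1.nvar 4 (by decide)).trans h4) rfl hpn).frame le_rfl
    fun s2 hag hs2 => And.intro hag hs2).seq (T' := 50 * d + 60) ?_).mono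
    (by rw [hn1]; lia) fun _ h => h
  rintro s2 ⟨hag2, hrow2, hrow2'⟩
  have hL2 := hL1.of_agree (hag2.mono (by decide) (by decide) (by decide) (by decide))
  refine (runs_weighCmd hL2 (i := i) ((hag2.nvar 4 (by decide)).trans
    ((hag1.nvar 4 (by decide)).trans h4))).frame le_rfl ?_
  rintro s3 hag3 ⟨h5, h6, h7⟩
  have hr3 : s3.rarr 2 = s2.rarr 2 := hag3.rarr 2 (by decide)
  have hrow3 : ∀ k, row d s3 k = row d s2 k := fun k => by rw [row, row, hr3]
  refine ⟨⟨s1.nvar 8, ⟨hp1, hp2⟩, hmax, ?_⟩, ?_, ?_, ?_, h7⟩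
  · rw [hrow3, hrow2, hrow1, hag1.rarr 5 (by decide)]
  · intro k hk
    rw [hrow3, hrow2' k hk, hrow1]
  · rw [h5, hrow3, hag2.rvar 1 (by decide), hag1.rvar 1 (by decide)]
  · rw [h6, hrow3, hag2.rvar 3 (by decide), hag1.rvar 3 (by decide), hag2.rarr 3 (by decide),
      hag1.rarr 3 (by decide)]

end SIB

/-! ### A complete round -/

namespace SIB

open RealRAM

variable {n d : ℕ} {q : ℕ → EuclideanSpace ℝ (Fin d)} {s s' : Store}

/-- Memory between two rounds: `t` rounds have been made, `G` are the gains, `Z` is the sum of the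
centers, `ℓ` is the logarithm of `n`, and `ρ` is the radius of the input. -/
structure RoundState (n : ℕ) (q : ℕ → EuclideanSpace ℝ (Fin d)) (s₀ : Store) (ℓ : ℕ) (ρ : ℝ) (t : ℕ)
    (G : ℕ → EuclideanSpace ℝ (Fin d)) (Z : EuclideanSpace ℝ (Fin d)) (s : Store) : Prop where
  same : SameInput s₀ s
  log_eq : s.nvar 2 = ℓ
  rounds_eq : s.nvar 9 = t
  radius_eq : s.rvar 2 = ρ
  origin_eq : vec d (s.rarr 4) = -q 0
  row_eq : ∀ k < n, row d s k = G k
  center_eq : vec d (s.rarr 1) = Z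
  weighted_eq : vec d (s.rarr 3) = ∑ k ∈ Finset.range n, weighted (rate ℓ (4 * ρ) t) (G k)
  le_max : ∀ k < n, ‖G k‖ ≤ s.rvar 1
  max_le : ∀ c : ℝ, 0 ≤ c → (∀ k < n, ‖G k‖ ≤ c) → s.rvar 1 ≤ c

/-- The best response of the center player. -/
noncomputable def bestCenter {E : Type*} [NormedAddCommGroup E] [InnerProductSpace ℝ E] (o : E)
    (ρ : ℝ) (S : E) : E := o - (3 * ρ / ‖S‖) • S

/-- Compute the next center and prepare for the loop over the groups. -/
def prepCmd : Cmd :=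
  .seq (.rset 7 (.ofNat (.const 0))) <|
  .seq (sumLoop 5 7 (.const 0) (.var 1) (.mul (.get 3 (.var 5)) (.get 3 (.var 5)))) <|
  .seq (.rset 7 (.div (.mul (.ofNat (.const 3)) (.var 2)) (.sqrt (.var 7)))) <|
  .seq (mapLoop 5 5 (.const 0) (.var 1)
    (.sub (.sub (.ofNat (.const 0)) (.get 4 (.var 5))) (.mul (.var 7) (.get 3 (.var 5))))) <|
  .seq (mapLoop 5 1 (.const 0) (.var 1) (.add (.get 1 (.var 5)) (.get 5 (.var 5)))) <|
  .seq (mapLoop 5 3 (.const 0) (.var 1) (.ofNat (.const 0))) <|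
  .seq (.nset 9 (.add (.var 9) (.const 1))) <|
  .seq (.rset 3 (.div (.sqrt (.div (.ofNat (.var 2)) (.ofNat (.add (.var 2) (.var 9)))))
    (.mul (.ofNat (.const 4)) (.var 2)))) <|
  .seq (.rset 1 (.ofNat (.const 0))) <|
  .nset 4 (.const 0)

/-- The center uses the weights left by the previous round. The round counter is advanced before the
rate is computed, so the rate stored is the one for the weights collected next. -/
theorem runs_prepCmd (h : s.nvar 1 = d) :
    Runs prepCmd s (100 * d + 100) fun s' =>
      vec d (s'.rarr 5) = bestCenter (-vec d (s.rarr 4)) (s.rvar 2) (vec d (s.rarr 3)) ∧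
      vec d (s'.rarr 1) = vec d (s.rarr 1) + vec d (s'.rarr 5) ∧
      vec d (s'.rarr 3) = 0 ∧ s'.nvar 9 = s.nvar 9 + 1 ∧
      s'.rvar 3 = rate (s.nvar 2) (4 * s.rvar 2) (s.nvar 9 + 1 : ℕ) ∧
      s'.rvar 1 = 0 ∧ s'.nvar 4 = 0 := by
  have hnorm : √(∑ k ∈ Finset.range d, s.rarr 3 k * s.rarr 3 k) = ‖vec d (s.rarr 3)‖ := by
    rw [Finset.range_eq_Ico, ← norm_vec_sq (d := d) (s.rarr 3), Real.sqrt_sq (norm_nonneg _)]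
  refine ((Runs.rset s 7 _).seq (T := 3) (T' := 100 * d + 97) ?_).mono (by lia) fun _ h => h
  rintro _ rfl
  refine ((runs_sumLoop (a := 0) (b := d) (U := 16 * d + 6)
    (f := fun j => s.rarr 3 j * s.rarr 3 j) rfl d.zero_le ?_ ?_ ?_).seq
    (T' := 84 * d + 91) ?_).mono (by lia) fun _ h => h
  · simp [NExp.eval, h]
  · simp [NExp.eval, RExp.eval]
  · simp only [NExp.cost, RExp.cost]; lia
  rintro _ rfl
  refine ((Runs.rset _ 7 _).seq (T := 8) (T' := 84 * d + 83) ?_).mono (by lia) fun _ h => h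
  rintro _ rfl
  simp only [RExp.eval, NExp.eval, Nat.cast_zero, Store.rvar_setR, Store.rvar_setN, if_true,
    zero_add, Nat.Ico_zero_eq_range, hnorm]
  set s1 := (((s.setR 7 0).setN 5 d).setR 7
    (∑ k ∈ Finset.range d, s.rarr 3 k * s.rarr 3 k)).setR 7
    (((3 : ℕ) : ℝ) * s.rvar 2 / ‖vec d (s.rarr 3)‖) with hs1
  refine ((runs_mapLoop (s := s1) (b := d) (o := 0) (U := 22 * d + 6)
    (f := fun j => 0 - s.rarr 4 j - 3 * s.rvar 2 / ‖vec d (s.rarr 3)‖ * s.rarr 3 j)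
    ?_ ?_ ?_ ?_).seq (T' := 62 * d + 77) ?_).mono (by lia) fun _ h => h
  · simp [NExp.eval]
  · simp [NExp.eval, hs1, h]
  · intro k g hk hg
    simp [NExp.eval, RExp.eval, hs1]
  · simp only [NExp.cost, RExp.cost]; lia
  rintro _ rfl
  set z : ℕ → ℝ := fun m => if 0 ≤ m ∧ m < 0 + d then 0 - s.rarr 4 (m - 0) -
    3 * s.rvar 2 / ‖vec d (s.rarr 3)‖ * s.rarr 3 (m - 0) else s1.rarr 5 m with hz
  refine ((runs_mapLoop (b := d) (o := 0) (U := 21 * d + 6)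
    (f := fun j => s.rarr 1 j + z j)
    ?_ ?_ ?_ ?_).seq (T' := 41 * d + 71) ?_).mono (by lia) fun _ h => h
  · simp [NExp.eval]
  · simp [NExp.eval, hs1, h]
  · intro k g hk hg
    simp [NExp.eval, RExp.eval, hs1, hg k (by lia)]
  · simp only [NExp.cost, RExp.cost]; lia
  rintro _ rfl
  refine ((runs_mapLoop (b := d) (o := 0) (U := 20 * d + 6)
    (f := fun j => 0)
    ?_ ?_ ?_ ?_).seq (T' := 20 * d + 65) ?_).mono (by lia) fun _ h => h
  · simp [NExp.eval]
  · simp [NExp.eval, hs1, h]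
  · intro k g hk hg
    simp [NExp.eval, RExp.eval]
  · simp only [NExp.cost, RExp.cost]; lia
  rintro _ rfl
  refine ((Runs.nset _ 9 _).seq (T := 4) (T' := 61) ?_).mono (by lia) fun _ h => h
  rintro _ rfl
  refine ((Runs.rset _ 3 _).seq (T := 14) (T' := 47) ?_).mono (by lia) fun _ h => h
  rintro _ rfl
  refine ((Runs.rset _ 1 _).seq (T := 3) (T' := 44) ?_).mono (by lia) fun _ h => h
  rintro _ rfl
  refine (Runs.nset _ 4 _).mono (by simp [NExp.cost]) ?_
  rintro _ rfl
  refine ⟨?_, ?_, ?_, ?_, ?_, ?_, ?_⟩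
  · ext j
    simp [bestCenter, hz]
  · ext j
    simp
  · ext j
    simp
  · simp [hs1, NExp.eval]
  · simp [hs1, NExp.eval, RExp.eval, rate]
  · simp [NExp.eval, RExp.eval]
  · simp [NExp.eval]

/-- One round. -/
def roundCmd : Cmd := .seq prepCmd (forLoop 3 (.const 0) (.var 0) groupCmd)

theorem runs_roundCmd {s₀ : Store} (h : Layout n q s₀) {ℓ t : ℕ} {ρ : ℝ}
    {G : ℕ → EuclideanSpace ℝ (Fin d)} {Z : EuclideanSpace ℝ (Fin d)}
    (hs : RoundState n q s₀ ℓ ρ t G Z s) :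
    Runs roundCmd s (46 * s₀.narr 1 (s₀.narr 0 n) + 64 * s₀.narr 0 n + 75 * (n * d) + 98 * n +
      100 * d + 106) fun s' => ∃ p : ℕ → ℕ,
      (∀ k < n, (s₀.narr 0 k ≤ p k ∧ p k < s₀.narr 0 (k + 1)) ∧
        ∀ p', s₀.narr 0 k ≤ p' → p' < s₀.narr 0 (k + 1) →
          inner ℝ (G k) (q p') ≤ inner ℝ (G k) (q (p k))) ∧
      RoundState n q s₀ ℓ ρ (t + 1)
        (fun k => G k + (bestCenter (q 0) ρ
          (∑ k ∈ Finset.range n, weighted (rate ℓ (4 * ρ) t) (G k)) - q (p k)))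
        (Z + bestCenter (q 0) ρ (∑ k ∈ Finset.range n, weighted (rate ℓ (4 * ρ) t) (G k))) s' := by
  obtain ⟨hsame, hlog, hrounds, hradius, horigin, hrow, hcenter, hweighted, -, -⟩ := hs
  set z := bestCenter (q 0) ρ (∑ k ∈ Finset.range n, weighted (rate ℓ (4 * ρ) t) (G k)) with hz
  have hL := h.of_agree hsame
  refine (((runs_prepCmd hL.nvar_one).frame le_rfl fun s1 hag hs1 => And.intro hag hs1).seq
    (T' := 46 * s₀.narr 1 (s₀.narr 0 n) + 64 * s₀.narr 0 n + 75 * (n * d) + 98 * n + 6) ?_).mono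
    (by lia) fun _ h => h
  rintro s1 ⟨hag1, h5, h1, h3, h9, hr3, hr1, hn4⟩
  rw [horigin, hradius, hweighted, neg_neg, ← hz] at h5
  rw [hcenter, h5] at h1
  rw [hlog, hradius, hrounds] at hr3
  rw [hrounds] at h9
  have hsame1 : SameInput s₀ s1 :=
    hsame.trans (hag1.mono (by decide) (by decide) (by decide) (by decide))
  have hL1 := h.of_agree hsame1
  have hrow1 : ∀ k < n, row d s1 k = G k := fun k hk => by
    rw [row, hag1.rarr 2 (by decide)]; exact hrow k hk
  have hn0 : s₀.narr 0 = s1.narr 0 := (hsame1.narr 0 (by decide)).symm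
  have hn1 : s₀.narr 1 = s1.narr 1 := (hsame1.narr 1 (by decide)).symm
  simp only [hn0, hn1]
  let D : Store → Store → Prop := Agree [3, 4, 5, 6, 7, 8] [1, 4, 5, 6] [] [2, 3]
  refine (runs_forLoop (a := 0) (b := n)
    (I := fun i s' => D s1 s' ∧ s'.nvar 4 = i * d ∧
      (∃ p : ℕ → ℕ, (∀ k < i, (s1.narr 0 k ≤ p k ∧ p k < s1.narr 0 (k + 1)) ∧
        (∀ p', s1.narr 0 k ≤ p' → p' < s1.narr 0 (k + 1) →
          inner ℝ (G k) (q p') ≤ inner ℝ (G k) (q (p k))) ∧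
        row d s' k = G k + (z - q (p k)))) ∧
      (∀ k, i ≤ k → k < n → row d s' k = G k) ∧
      vec d (s'.rarr 3) =
        ∑ k ∈ Finset.range i, weighted (rate ℓ (4 * ρ) (t + 1 : ℕ)) (row d s' k) ∧
      (∀ k < i, ‖row d s' k‖ ≤ s'.rvar 1) ∧
      ∀ c : ℝ, 0 ≤ c → (∀ k < i, ‖row d s' k‖ ≤ c) → s'.rvar 1 ≤ c)
    -- Both index arrays are prefix sums, so the costs of the groups telescope to the total numbers
    -- of entries and points.
    (T := fun i => 46 * s1.narr 1 (s1.narr 0 i) + 64 * s1.narr 0 i + 75 * (i * d) + 98 * i)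
    (by simp [Cmd.modN, groupCmd, pickCmd, moveCmd, weighCmd, argmaxLoop, sumLoop, mapLoop,
      scatterLoop, forLoop]) rfl n.zero_le ?_ ?_ ?_ ?_).mono le_rfl ?_
  · have hz4 : ∀ k, row d (s1.setN 3 0) k = row d s1 k := fun k => rfl
    refine ⟨⟨fun x hx => ?_, fun _ _ => rfl, fun _ _ => rfl, fun _ _ => rfl⟩, by simp [hn4],
      ⟨fun _ => 0, fun k hk => absurd hk k.not_lt_zero⟩, fun k _ hk => hrow1 k hk, by simpa using h3,
      fun k hk => absurd hk k.not_lt_zero, fun c hc _ => by simpa [hr1] using hc⟩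
    have : x ≠ 3 := by rintro rfl; exact hx (by decide)
    simp [this]
  · rintro i s' - - ⟨hD, -⟩ -
    exact (hD.nvar 0 (by decide)).trans hL1.nvar_zero
  · rintro i s2 - hi ⟨hD, h4, ⟨p, hp⟩, hge, hw, hle, hleast⟩ hi3
    have hL2 := hL1.of_agree (hD.mono (by decide) (by decide) (by decide) (by decide))
    have h20 : s2.narr 0 = s1.narr 0 := hD.narr 0 (by decide)
    have h21 : s2.narr 1 = s1.narr 1 := hD.narr 1 (by decide)
    have hm1 : s1.narr 0 i ≤ s1.narr 0 (i + 1) := (hL1.group_lt i hi).le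
    have hm2 : s1.narr 1 (s1.narr 0 i) ≤ s1.narr 1 (s1.narr 0 (i + 1)) :=
      hL1.point_mono hm1 (hL1.group_mono (by lia) le_rfl)
    refine ⟨_, ?_, (runs_groupCmd hL2 hi hi3 h4).frame le_rfl ?_⟩
    · simp only [h20, h21, NExp.cost]
      rw [Nat.succ_mul]
      lia
    rintro s3 hag ⟨⟨p', ⟨hp1, hp2⟩, hpmax, hpi⟩, hother, hr1', hr3', h4'⟩
    rw [h20] at hp1 hp2 hpmax
    have hr53 : s2.rvar 3 = rate ℓ (4 * ρ) (t + 1 : ℕ) := (hD.rvar 3 (by decide)).trans hr3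
    have hz5 : vec d (s2.rarr 5) = z := by rw [hD.rarr 5 (by decide), h5]
    have hrowset : ∀ k, row d (s3.setN 3 (i + 1)) k = row d s3 k := fun k => rfl
    have hrowi := hge i le_rfl hi
    refine ⟨?_, by simpa using h4', ⟨fun k => if k = i then p' else p k, ?_⟩, ?_, ?_, ?_, ?_⟩
    · refine hD.trans ((hag.mono (by decide) (by decide) (by decide) (by decide)).trans
        ⟨fun x hx => ?_, fun _ _ => rfl, fun _ _ => rfl, fun _ _ => rfl⟩)
      have : x ≠ 3 := by rintro rfl; exact hx (by decide)
      simp [this]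
    · intro k hk
      simp only [hrowset]
      rcases Nat.lt_succ_iff_lt_or_eq.1 hk with hlt | rfl
      · rw [if_neg hlt.ne, hother k hlt.ne]
        exact hp k hlt
      · rw [if_pos rfl, hpi, hz5, hrowi]
        rw [hrowi] at hpmax
        exact ⟨⟨hp1, hp2⟩, hpmax, rfl⟩
    · intro k hik hk
      rw [hrowset, hother k (by lia)]
      exact hge k (by lia) hk
    · rw [Finset.sum_range_succ]
      simp only [hrowset, Store.rarr_setN]
      rw [hr3', hw, hr53]
      congr 1
      refine Finset.sum_congr rfl fun k hk => ?_
      rw [hother k (Finset.mem_range.1 hk).ne]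
    · intro k hk
      simp only [hrowset, Store.rvar_setN]
      rw [hr1']
      rcases Nat.lt_succ_iff_lt_or_eq.1 hk with hlt | rfl
      · rw [hother k hlt.ne]
        exact (hle k hlt).trans (le_max_left _ _)
      · exact le_max_right _ _
    · intro c hc hck
      simp only [hrowset, Store.rvar_setN] at hck ⊢
      rw [hr1']
      refine max_le (hleast c hc fun k hk => ?_) (hck i (by lia))
      rw [← hother k hk.ne]
      exact hck k (by lia)
  · simp only [NExp.cost]; lia
  · rintro s' ⟨⟨hD, -, ⟨p, hp⟩, -, hw, hle, hleast⟩, -⟩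
    refine ⟨p, fun k hk => ⟨(hp k hk).1, (hp k hk).2.1⟩, ?_⟩
    refine ⟨hsame1.trans (hD.mono (by decide) (by decide) (by decide) (by decide)), ?_, ?_, ?_, ?_,
      fun k hk => (hp k hk).2.2, ?_, ?_, fun k hk => ?_, fun c hc hck => hleast c hc fun k hk => ?_⟩
    · rw [hD.nvar 2 (by decide), hag1.nvar 2 (by decide), hlog]
    · rw [hD.nvar 9 (by decide), h9]
    · rw [hD.rvar 2 (by decide), hag1.rvar 2 (by decide), hradius]
    · rw [hD.rarr 4 (by decide), hag1.rarr 4 (by decide), horigin]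
    · rw [hD.rarr 1 (by decide), h1]
    · rw [hw]
      refine Finset.sum_congr rfl fun k hk => ?_
      rw [(hp k (Finset.mem_range.1 hk)).2.2]
    · rw [← (hp k hk).2.2]; exact hle k hk
    · rw [(hp k hk).2.2]; exact hck k hk

end SIB

/-! ### Initialization, output, and the whole program -/

namespace SIB

open RealRAM

variable {n d : ℕ} {q : ℕ → EuclideanSpace ℝ (Fin d)} {s : Store}

/-- Set the vectors in the real arrays `1` and `3` to zero, and write the negative of point `0` to the
real array `4`. -/
def clearCmd : Cmd :=
  .seq (mapLoop 5 1 (.const 0) (.var 1) (.ofNat (.const 0))) <|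
  .seq (mapLoop 5 3 (.const 0) (.var 1) (.ofNat (.const 0))) <|
  .seq (mapLoop 5 4 (.const 0) (.var 1) (.ofNat (.const 0))) <|
  scatterLoop 7 4 (.get 1 (.const 0)) (.get 1 (.const 1)) (.get 2 (.var 7)) (.get 0 (.var 7))

/-- Scattering subtracts, so starting from zero it produces `-q 0`; the negative sign is the one
needed for differences from point `0`. -/
theorem runs_clearCmd (h : Layout n q s) (hM : 0 < s.narr 0 n) :
    Runs clearCmd s (60 * d + 20 * s.narr 1 (s.narr 0 n) + 40) fun s' =>
      vec d (s'.rarr 1) = 0 ∧ vec d (s'.rarr 3) = 0 ∧ vec d (s'.rarr 4) = -q 0 := by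
  have h1 := h.nvar_one
  have hE : s.narr 1 1 ≤ s.narr 1 (s.narr 0 n) := h.point_mono hM le_rfl
  have hzero : ∀ (A : ℕ) (u : Store), u.nvar 1 = d →
      Runs (mapLoop 5 A (.const 0) (.var 1) (.ofNat (.const 0))) u (20 * d + 6) fun u' =>
        u' = (u.setN 5 d).setA A fun m => if 0 ≤ m ∧ m < 0 + d then 0 else u.rarr A m := by
    intro A u hu
    refine runs_mapLoop (b := d) (o := 0) (f := fun _ => 0) ?_ ?_ ?_ ?_
    · simp [NExp.eval]
    · simp [NExp.eval, hu]
    · simp [NExp.eval, RExp.eval]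
    · simp only [NExp.cost, RExp.cost]; lia
  refine ((hzero 1 s h1).seq (T' := 40 * d + 20 * s.narr 1 (s.narr 0 n) + 34) ?_).mono (by lia)
    fun _ h => h
  rintro _ rfl
  refine ((hzero 3 _ (by simpa using h1)).seq
    (T' := 20 * d + 20 * s.narr 1 (s.narr 0 n) + 28) ?_).mono (by lia) fun _ h => h
  rintro _ rfl
  refine ((hzero 4 _ (by simpa using h1)).seq
    (T' := 20 * s.narr 1 (s.narr 0 n) + 22) ?_).mono (by lia) fun _ h => h
  rintro _ rfl
  refine (runs_scatterLoop (a := 0) (b := s.narr 1 1) (p := s.narr 2) (f := s.rarr 0) ?_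
    (Nat.zero_le _) ?_ ?_ ?_ ?_).mono le_rfl ?_
  · simp [NExp.eval, h.point_zero]
  · simp [NExp.eval]
  · simp [NExp.eval]
  · simp [NExp.eval, RExp.eval]
  · simp only [NExp.cost, RExp.cost]; lia
  rintro _ rfl
  refine ⟨?_, ?_, ?_⟩
  · ext j; simp
  · ext j; simp
  · ext j
    have := h.sum_entries_single hM j
    rw [h.point_zero, zero_add, ← Finset.range_eq_Ico] at this
    simp [this]

/-- Set the matrix to zero. -/
def clearRowsCmd : Cmd :=
  .seq (.nset 4 (.const 0)) <| forLoop 3 (.const 0) (.var 0) <|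
    .seq (mapLoop 5 2 (.var 4) (.var 1) (.ofNat (.const 0))) (.nset 4 (.add (.var 4) (.var 1)))

theorem runs_clearRowsCmd (h : Layout n q s) :
    Runs clearRowsCmd s (20 * (n * d) + 20 * n + 20) fun s' => ∀ k < n, row d s' k = 0 := by
  refine ((Runs.nset s 4 _).seq (T := 2) (T' := 20 * (n * d) + 20 * n + 18) ?_).mono
    (by lia) fun _ h => h
  rintro _ rfl
  set s1 := s.setN 4 (NExp.eval s (.const 0)) with hs1
  refine (runs_forLoop (a := 0) (b := n)
    (I := fun i s' => Agree [3, 4, 5] [] [] [2] s s' ∧ s'.nvar 4 = i * d ∧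
      ∀ k < i, row d s' k = 0)
    (T := fun i => 20 * (i * d) + 20 * i)
    (by simp [Cmd.modN, mapLoop, forLoop]) rfl n.zero_le ?_ ?_ ?_ ?_).mono le_rfl ?_
  · refine ⟨⟨fun x hx => ?_, fun _ _ => rfl, fun _ _ => rfl, fun _ _ => rfl⟩, ?_,
      fun k hk => absurd hk k.not_lt_zero⟩
    · have : x ≠ 3 := by rintro rfl; exact hx (by decide)
      have : x ≠ 4 := by rintro rfl; exact hx (by decide)
      simp [*]
    · simp [hs1, NExp.eval]
  · rintro i s' - - ⟨hag, -⟩ -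
    exact (hag.nvar 0 (by decide)).trans h.nvar_zero
  · rintro i s' - hi ⟨hag, h4, hrow⟩ h3
    have h1 : s'.nvar 1 = d := (hag.nvar 1 (by decide)).trans h.nvar_one
    refine ⟨(20 * d + 6) + 4, ?_, ((runs_mapLoop (s := s') (b := d) (o := i * d)
      (f := fun _ => 0) (U := 20 * d + 6) ?_ ?_ ?_ ?_).seq (T' := 4) ?_)⟩
    · simp only [NExp.cost]
      rw [Nat.succ_mul]
      lia
    · simp [NExp.eval, h4]
    · simp [NExp.eval, h1]
    · simp [RExp.eval, NExp.eval]
    · simp only [NExp.cost, RExp.cost]; lia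
    rintro _ rfl
    refine (Runs.nset _ 4 _).mono (by simp [NExp.cost]) ?_
    rintro _ rfl
    refine ⟨hag.trans ⟨fun x hx => ?_, fun _ _ => rfl, fun _ _ => rfl, fun x hx => ?_⟩, ?_, ?_⟩
    · have : x ≠ 3 := by rintro rfl; exact hx (by decide)
      have : x ≠ 4 := by rintro rfl; exact hx (by decide)
      have : x ≠ 5 := by rintro rfl; exact hx (by decide)
      simp [*]
    · have : x ≠ 2 := by rintro rfl; exact hx (by decide)
      simp [*]
    · simp [NExp.eval, h4, h1, Nat.succ_mul]
    · intro k hk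
      ext j
      have hj := j.2
      rcases Nat.lt_succ_iff_lt_or_eq.1 hk with hlt | rfl
      · have := congrArg (fun v => v j) (hrow k hlt)
        simp only [row, vec_apply, PiLp.zero_apply] at this
        simp [row, this]
      · simp [row]
  · simp only [NExp.cost]; lia
  · rintro s' ⟨⟨-, -, h⟩, -⟩
    exact h

/-- Compute the maximal distance from point `0`. -/
def measureCmd : Cmd :=
  .seq (.rset 3 (.ofNat (.const 0))) <|
  .seq (sumLoop 5 3 (.const 0) (.var 1) (.mul (.get 4 (.var 5)) (.get 4 (.var 5)))) <|
  .seq (argmaxLoop (.const 0) (.get 0 (.var 0)) (.var 3)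
    (.mul (.get 0 (.var 7)) (.add (.get 0 (.var 7))
      (.mul (.ofNat (.const 2)) (.get 4 (.get 2 (.var 7))))))) <|
  .rset 2 (.sqrt (.var 5))

theorem runs_measureCmd (h : Layout n q s) (hM : 0 < s.narr 0 n)
    (h4 : vec d (s.rarr 4) = -q 0) :
    Runs measureCmd s (20 * d + 30 * s.narr 1 (s.narr 0 n) + 60 * s.narr 0 n + 40) fun s' =>
      (∀ p < s.narr 0 n, ‖q p - q 0‖ ≤ s'.rvar 2) ∧ ∃ p < s.narr 0 n, ‖q p - q 0‖ = s'.rvar 2 := by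
  have h1 := h.nvar_one
  refine ((Runs.rset s 3 _).seq (T := 3)
    (T' := 20 * d + 30 * s.narr 1 (s.narr 0 n) + 60 * s.narr 0 n + 37) ?_).mono
    (by lia) fun _ h => h
  rintro _ rfl
  refine ((runs_sumLoop (a := 0) (b := d) (U := 20 * d + 6)
    (f := fun j => s.rarr 4 j * s.rarr 4 j) rfl d.zero_le ?_ ?_ ?_).seq
    (T' := 30 * s.narr 1 (s.narr 0 n) + 60 * s.narr 0 n + 31) ?_).mono (by lia) fun _ h => h
  · simp [NExp.eval, h1]
  · simp [NExp.eval, RExp.eval]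
  · simp only [NExp.cost, RExp.cost]; lia
  rintro _ rfl
  simp only [RExp.eval, NExp.eval, Nat.cast_zero, Store.rvar_setR, if_true, zero_add,
    ← norm_vec_sq, h4, norm_neg]
  -- Expanding `‖q p - q 0‖²` leaves the common term `‖q 0‖²`, computed once, and a sum over the
  -- nonzero coordinates of `q p`. Thus all distances cost a single scan of the input.
  have hφ : ∀ p < s.narr 0 n, ‖q 0‖ ^ 2 + ∑ e ∈ Finset.Ico (s.narr 1 p) (s.narr 1 (p + 1)),
      s.rarr 0 e * (s.rarr 0 e + 2 * s.rarr 4 (s.narr 2 e)) = ‖q p - q 0‖ ^ 2 := by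
    intro p hp
    rw [h.sum_entries p hp (fun j x => x * (x + 2 * s.rarr 4 j)) (by simp), sub_eq_add_neg,
      norm_add_sq_real, norm_neg, ← h4, real_inner_comm, inner_vec, EuclideanSpace.norm_sq_eq (q p)]
    simp only [mul_add, Finset.sum_add_distrib, Finset.mul_sum, Real.norm_eq_abs, sq_abs]
    rw [add_comm]
    congr 2
    · exact Finset.sum_congr rfl fun j _ => (sq _).symm
    · exact Finset.sum_congr rfl fun j _ => by ring
  set s1 := ((s.setR 3 0).setN 5 d).setR 3 (‖q 0‖ ^ 2) with hs1
  refine ((runs_argmaxLoop (s := s1) (a := 0) (b := s.narr 0 n) (c := ‖q 0‖ ^ 2)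
    (f := fun e => s.rarr 0 e * (s.rarr 0 e + 2 * s.rarr 4 (s.narr 2 e))) hM
    (fun p _ hp => h.point_le p hp) ?_ ?_ ?_ ?_ le_rfl).seq (T' := 3) ?_).mono ?_ fun _ h => h
  · intro s' hs
    simp [NExp.eval]
  · intro s' hs
    simp [NExp.eval, hs.nvar 0 (by decide), hs.narr 0 (by decide), hs1, h.nvar_zero]
  · intro s' hs
    simp [RExp.eval, hs.rvar 3 (by decide), hs1]
  · intro s' hs
    simp [NExp.eval, RExp.eval, hs.narr 2 (by decide), hs.rarr 0 (by decide),
      hs.rarr 4 (by decide), hs1]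
  · rintro s' ⟨⟨-, h8⟩, h5, hmax⟩
    refine (Runs.rset _ 2 _).mono (by simp [RExp.cost]) ?_
    rintro _ rfl
    have hn1 : s1.narr 1 = s.narr 1 := rfl
    rw [hn1, hφ _ h8] at h5
    have hsq : √(s'.rvar 5) = ‖q (s'.nvar 8) - q 0‖ := by rw [h5, Real.sqrt_sq (norm_nonneg _)]
    refine ⟨fun p hp => ?_, s'.nvar 8, h8, ?_⟩
    · have := hmax p p.zero_le hp
      rw [hn1, hφ p hp] at this
      simpa [RExp.eval] using Real.le_sqrt_of_sq_le this
    · simp [RExp.eval, hsq]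
  · simp only [NExp.cost, RExp.cost, hs1, Store.narr_setR, Store.narr_setN]
    lia

/-- Compute the logarithm of the number of groups, rounded up. -/
def logCmd : Cmd :=
  .seq (.nset 10 (.const 1)) <| .seq (.nset 2 (.const 0)) <|
    .loop (.nlt (.var 10) (.var 0)) <|
      .seq (.nset 10 (.add (.var 10) (.var 10))) (.nset 2 (.add (.var 2) (.const 1)))

/-- Reals cannot be rounded to naturals, so the logarithm is found by counting doublings until `n`
is reached. -/
theorem runs_logCmd (h : s.nvar 0 = n) :
    Runs logCmd s (12 * Nat.clog 2 n + 8) fun s' => s'.nvar 2 = Nat.clog 2 n := by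
  refine ((Runs.nset s 10 _).seq (T := 2) (T' := 12 * Nat.clog 2 n + 6) ?_).mono
    (by lia) fun _ h => h
  rintro _ rfl
  refine ((Runs.nset _ 2 _).seq (T := 2) (T' := 12 * Nat.clog 2 n + 4) ?_).mono
    (by lia) fun _ h => h
  rintro _ rfl
  refine (Runs.loop (k := 0) (K := Nat.clog 2 n) (T := fun k => 12 * k)
    (I := fun k s' => s'.nvar 10 = 2 ^ k ∧ s'.nvar 2 = k ∧ s'.nvar 0 = n ∧ k ≤ Nat.clog 2 n)
    ?_ ?_ ?_ ?_).mono le_rfl ?_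
  · rintro k s' ⟨h10, h2, h0, hk⟩ hb
    simp only [BExp.holds, NExp.eval, h10, h0] at hb
    have hk' := (Nat.lt_clog_iff_pow_lt (by norm_num)).2 hb
    refine ⟨hk', 8, by simp only [BExp.cost, NExp.cost]; lia, ?_⟩
    refine (Runs.nset _ _ _).seq (T := 4) (T' := 4) ?_
    rintro _ rfl
    refine (Runs.nset _ _ _).mono (by simp [NExp.cost]) ?_
    rintro _ rfl
    refine ⟨?_, ?_, ?_, hk'⟩
    · simp [NExp.eval, h10, pow_succ, mul_two]
    · simp [NExp.eval, h2]
    · simp [h0]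
  · rintro k s' ⟨-, -, -, hk⟩ -
    lia
  · simp [NExp.eval, h]
  · simp only [BExp.cost, NExp.cost]; lia
  · rintro s' ⟨k, ⟨h10, h2, h0, hk⟩, hb⟩
    simp only [BExp.holds, NExp.eval, h10, h0] at hb
    rw [h2]
    exact le_antisymm hk (Nat.clog_le_of_le_pow (not_lt.1 hb))

/-- The initialization. -/
def initCmd : Cmd :=
  .seq clearCmd <| .seq clearRowsCmd <| .seq measureCmd <| .seq logCmd <|
    .seq (.nset 9 (.const 0)) (.rset 1 (.ofNat (.const 0)))

theorem runs_initCmd (h : Layout n q s) (hM : 0 < s.narr 0 n) :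
    Runs initCmd s (80 * d + 50 * s.narr 1 (s.narr 0 n) + 60 * s.narr 0 n + 20 * (n * d) + 20 * n +
      12 * Nat.clog 2 n + 120) fun s' =>
      (∀ p < s.narr 0 n, ‖q p - q 0‖ ≤ s'.rvar 2) ∧
      (∃ p < s.narr 0 n, ‖q p - q 0‖ = s'.rvar 2) ∧
      RoundState n q s (Nat.clog 2 n) (s'.rvar 2) 0 0 0 s' := by
  refine (((runs_clearCmd h hM).frame le_rfl fun _ h h' => And.intro h h').seq
    (T' := 20 * d + 30 * s.narr 1 (s.narr 0 n) + 60 * s.narr 0 n + 20 * (n * d) + 20 * n +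
      12 * Nat.clog 2 n + 80) ?_).mono (by lia) fun _ h => h
  rintro s1 ⟨hag1, h11, h13, h14⟩
  have hsame1 : SameInput s s1 := hag1.mono (by decide) (by decide) (by decide) (by decide)
  refine (((runs_clearRowsCmd (h.of_agree hsame1)).frame le_rfl fun _ h h' => And.intro h h').seq
    (T' := 20 * d + 30 * s.narr 1 (s.narr 0 n) + 60 * s.narr 0 n +
      12 * Nat.clog 2 n + 60) ?_).mono (by lia) fun _ h => h
  rintro s2 ⟨hag2, hrow⟩
  have hsame2 : SameInput s s2 :=
    hsame1.trans (hag2.mono (by decide) (by decide) (by decide) (by decide))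
  have h20 : s2.narr 0 = s.narr 0 := hsame2.narr 0 (by decide)
  have h21 : s2.narr 1 = s.narr 1 := hsame2.narr 1 (by decide)
  refine (((runs_measureCmd (h.of_agree hsame2) (by rw [h20]; exact hM)
    (by rw [hag2.rarr 4 (by decide), h14])).frame le_rfl fun _ h h' => And.intro h h').seq
    (T' := 12 * Nat.clog 2 n + 20) ?_).mono (by rw [h20, h21]; lia) fun _ h => h
  rintro s3 ⟨hag3, hle, hmax⟩
  rw [h20] at hle hmax
  have hsame3 : SameInput s s3 :=
    hsame2.trans (hag3.mono (by decide) (by decide) (by decide) (by decide))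
  refine (((runs_logCmd (h.of_agree hsame3).nvar_zero).frame le_rfl
    fun _ h h' => And.intro h h').seq (T' := 6) ?_).mono (by lia) fun _ h => h
  rintro s4 ⟨hag4, hlog⟩
  have hsame4 : SameInput s s4 :=
    hsame3.trans (hag4.mono (by decide) (by decide) (by decide) (by decide))
  have h42 : s4.rvar 2 = s3.rvar 2 := hag4.rvar 2 (by decide)
  refine (((Runs.nset s4 9 _).frame le_rfl fun _ h h' => And.intro h h').seq (T := 2) (T' := 3)
    ?_).mono (by lia) fun _ h => h
  rintro _ ⟨hag5, rfl⟩
  refine (Runs.rset _ 1 _).frame (by simp [RExp.cost, NExp.cost]) ?_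
  rintro _ hag6 rfl
  have hsame6 := (hsame4.trans (hag5.mono (by decide) (by decide) (by decide) (by decide))).trans
    (hag6.mono (by decide) (by decide) (by decide) (by decide))
  have hr1 : s4.rarr 1 = s1.rarr 1 := by
    rw [hag4.rarr 1 (by decide), hag3.rarr 1 (by decide), hag2.rarr 1 (by decide)]
  have hr3 : s4.rarr 3 = s1.rarr 3 := by
    rw [hag4.rarr 3 (by decide), hag3.rarr 3 (by decide), hag2.rarr 3 (by decide)]
  have hr4 : s4.rarr 4 = s1.rarr 4 := by
    rw [hag4.rarr 4 (by decide), hag3.rarr 4 (by decide), hag2.rarr 4 (by decide)]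
  have hr2 : s4.rarr 2 = s2.rarr 2 := by
    rw [hag4.rarr 2 (by decide), hag3.rarr 2 (by decide)]
  refine ⟨?_, ?_, hsame6, ?_, ?_, rfl, ?_, ?_, ?_, ?_, ?_, ?_⟩
  · simpa [h42] using hle
  · simpa [h42] using hmax
  · simpa using hlog
  · simp [NExp.eval]
  · simpa [hr4] using h14
  · intro k hk
    have := hrow k hk
    simpa [row, hr2] using this
  · simpa [hr1] using h11
  -- The rate variable has not been set yet, but all gains are zero and hence so are the weights at
  -- any rate.
  · simpa [hr3, weighted] using h13
  · simp [RExp.eval, NExp.eval]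
  · intro c hc _
    simpa [RExp.eval, NExp.eval] using hc

/-- Divide the sums by the number of rounds. -/
def outputCmd : Cmd :=
  .seq (.rset 1 (.div (.var 1) (.ofNat (.var 9))))
    (mapLoop 5 1 (.const 0) (.var 1) (.div (.get 1 (.var 5)) (.ofNat (.var 9))))

theorem runs_outputCmd (h : s.nvar 1 = d) :
    Runs outputCmd s (20 * d + 20) fun s' =>
      outRadius s' = s.rvar 1 / s.nvar 9 ∧
      outCenter d s' = (s.nvar 9 : ℝ)⁻¹ • vec d (s.rarr 1) := by
  refine ((Runs.rset s 1 _).seq (T := 5) (T' := 20 * d + 6) ?_).mono (by lia) fun _ h => h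
  rintro _ rfl
  refine (runs_mapLoop (b := d) (o := 0) (f := fun j => s.rarr 1 j / s.nvar 9) ?_ ?_ ?_ ?_).mono
    le_rfl ?_
  · simp [NExp.eval]
  · simp [NExp.eval, h]
  · intro k g hk hg
    simp [NExp.eval, RExp.eval, hg k (by lia)]
  · simp only [NExp.cost, RExp.cost]; lia
  rintro _ rfl
  constructor
  · simp [outRadius, RExp.eval, NExp.eval]
  · ext j
    simp [outCenter, RExp.eval, NExp.eval, div_eq_inv_mul]

/-- The algorithm. -/
def sibCmd : Cmd :=
  .seq initCmd <| .seq
    (.loop (.rlt (.mul (.var 0) (.var 1)) (.mul (.mul (.ofNat (.const 40)) (.var 2))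
      (.sqrt (.mul (.ofNat (.var 2)) (.ofNat (.add (.var 2) (.var 9))))))) roundCmd) outputCmd

end SIB

namespace SIB

open RealRAM

/-! ### From the input encoding to the layout used by the program -/

section Encoding

theorem sum_fin_of_step {n : ℕ} (f : ℕ → ℕ) (g : Fin n → ℕ) (h0 : f 0 = 0)
    (h : ∀ i : Fin n, f ((i : ℕ) + 1) = f i + g i) : f n = ∑ i, g i := by
  induction n with
  | zero => simpa using h0
  | succ n ih =>
    rw [Fin.sum_univ_castSucc, ← ih (fun i => g i.castSucc) fun i => h i.castSucc]
    exact h (Fin.last n)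

variable {n d : ℕ}

theorem nnz_eq_card (v : EuclideanSpace ℝ (Fin d)) :
    nnz v = (Finset.univ.filter fun j => v j ≠ 0).card := by
  rw [nnz, ← Set.ncard_coe_finset]
  congr 1
  ext j
  simp

/-- The entries of a sparse vector are its nonzero coordinates. -/
theorem entries_of_nnz {v : EuclideanSpace ℝ (Fin d)} {a b : ℕ} {idx : ℕ → ℕ} {val : ℕ → ℝ}
    (hcard : b = a + nnz v)
    (h : ∀ j : Fin d, v j ≠ 0 → ∃ e ∈ Ico a b, idx e = j ∧ val e = v j) :
    (∀ e ∈ Ico a b, idx e < d) ∧ ∀ F : ℕ → ℝ → ℝ, (∀ j, F j 0 = 0) →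
      ∑ e ∈ Finset.Ico a b, F (idx e) (val e) = ∑ j : Fin d, F j (v j) := by
  classical
  choose! e he h1 h2 using h
  set T := Finset.univ.filter fun j => v j ≠ 0 with hT
  have hmem : ∀ j ∈ T, v j ≠ 0 := fun j hj => (Finset.mem_filter.1 hj).2
  have hinj : Set.InjOn e T := by
    intro j hj k hk hjk
    have h3 := h1 j (hmem j hj)
    rw [hjk, h1 k (hmem k hk)] at h3
    exact Fin.ext h3.symm
  have himg : T.image e = Finset.Ico a b := by
    refine Finset.eq_of_subset_of_card_le ?_ ?_
    · intro x hx
      obtain ⟨j, hj, rfl⟩ := Finset.mem_image.1 hx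
      simpa using he j (hmem j hj)
    · rw [Finset.card_image_of_injOn hinj, Nat.card_Ico, hT, ← nnz_eq_card]
      lia
  constructor
  · intro x hx
    have : x ∈ T.image e := by rw [himg]; simpa using hx
    obtain ⟨j, hj, rfl⟩ := Finset.mem_image.1 this
    rw [h1 j (hmem j hj)]
    exact j.2
  · intro F hF
    rw [← himg, Finset.sum_image hinj, ← Finset.sum_filter_add_sum_filter_not Finset.univ
      (fun j => v j ≠ 0) fun j => F j (v j), ← hT]
    rw [Finset.sum_eq_zero (s := Finset.univ.filter fun j => ¬ v j ≠ 0), add_zero]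
    · exact Finset.sum_congr rfl fun j hj => by rw [h1 j (hmem j hj), h2 j (hmem j hj)]
    · intro j hj
      have : v j = 0 := by simpa using hj
      rw [this, hF]

/-- Besides the layout, this bounds the number of points by `N + n`, so that work per point fits
into the time bound. -/
theorem Encodes.exists_layout {P : Fin n → Finset (EuclideanSpace ℝ (Fin d))} {ε : ℝ} {s : Store}
    (h : Encodes P ε s) (hP : ∀ i, (P i).Nonempty) :
    ∃ q : ℕ → EuclideanSpace ℝ (Fin d), Layout n q s ∧
      (∀ i : Fin n, q '' Ico (s.narr 0 i) (s.narr 0 ((i : ℕ) + 1)) = P i) ∧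
      s.narr 1 (s.narr 0 n) = totalNnz P ∧ s.narr 0 n ≤ totalNnz P + n := by
  classical
  obtain ⟨h0, h1, -, q, hg0, hg, hq, hp0, hp, he⟩ := h
  refine ⟨q, ⟨h0, h1, hg0, ?_, hp0, ?_, ?_, ?_⟩, hq, ?_, ?_⟩
  · intro i hi
    have := hg ⟨i, hi⟩
    have := (hP ⟨i, hi⟩).card_pos
    simp only at *
    lia
  · intro t ht
    rw [hp t ht]
    exact Nat.le_add_right _ _
  · exact fun t ht => (entries_of_nnz (hp t ht) (he t ht)).1
  · exact fun t ht => (entries_of_nnz (hp t ht) (he t ht)).2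
  · refine sum_fin_of_step (fun i => s.narr 1 (s.narr 0 i)) _ (by simp [hg0, hp0]) fun i => ?_
    have himg : (Finset.Ico (s.narr 0 i) (s.narr 0 ((i : ℕ) + 1))).image q = P i := by
      rw [← Finset.coe_inj, ← hq i]
      simp
    -- The interval has as many elements as its image `P i`, so no point of a group is listed twice.
    have hinj : Set.InjOn q (Finset.Ico (s.narr 0 i) (s.narr 0 ((i : ℕ) + 1))) := by
      rw [← Finset.card_image_iff, himg, Nat.card_Ico, hg i]
      lia
    have hM : ∀ j : ℕ, j ≤ n → s.narr 0 j ≤ s.narr 0 n := by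
      intro j hj
      refine Nat.decreasingInduction' (P := fun j => s.narr 0 j ≤ s.narr 0 n) ?_ hj le_rfl
      intro k hk _ ih
      have := hg ⟨k, hk⟩
      simp only at this
      lia
    have hsum : ∀ b, s.narr 0 i ≤ b → b ≤ s.narr 0 ((i : ℕ) + 1) →
        s.narr 1 b = s.narr 1 (s.narr 0 i) + ∑ t ∈ Finset.Ico (s.narr 0 i) b, nnz (q t) := by
      intro b hb
      induction b, hb using Nat.le_induction with
      | base => simp
      | succ b hb ih =>
        intro hb'
        rw [hp b (by have := hM (i + 1) i.2; lia), ih (by lia), Finset.sum_Ico_succ_top hb, add_assoc]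
    rw [← himg, Finset.sum_image hinj]
    exact hsum _ (by rw [hg i]; lia) le_rfl
  · have hM : s.narr 0 n = ∑ i, (P i).card := sum_fin_of_step (s.narr 0) _ hg0 hg
    -- Points of a group are distinct, so at most one is the origin, and every other point has a
    -- nonzero coordinate.
    have hcard : ∀ i, (P i).card ≤ (∑ p ∈ P i, nnz p) + 1 := by
      intro i
      have h1 : ∑ p ∈ (P i).erase 0, 1 ≤ ∑ p ∈ (P i).erase 0, nnz p := by
        refine Finset.sum_le_sum fun p hp => ?_
        have hp0 := Finset.ne_of_mem_erase hp
        rw [nnz_eq_card]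
        refine Finset.card_pos.2 ?_
        by_contra hne
        rw [Finset.not_nonempty_iff_eq_empty, Finset.filter_eq_empty_iff] at hne
        exact hp0 (by ext j; simpa using hne (Finset.mem_univ j))
      have h2 : ∑ p ∈ (P i).erase 0, nnz p ≤ ∑ p ∈ P i, nnz p :=
        Finset.sum_le_sum_of_subset (Finset.erase_subset _ _)
      have h3 := Finset.pred_card_le_card_erase (s := P i) (a := 0)
      simp only [Finset.sum_const, smul_eq_mul, mul_one] at h1
      lia
    rw [hM]
    refine (Finset.sum_le_sum fun i _ => hcard i).trans ?_
    simp [Finset.sum_add_distrib, totalNnz]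

end Encoding

/-! ### The optimal radius and best responses -/

section Geometry

variable {n d : ℕ} {Ω : Fin n → Set (EuclideanSpace ℝ (Fin d))}

theorem optRadius_le {z : EuclideanSpace ℝ (Fin d)} {r : ℝ} (h : Feasible Ω z r) :
    optRadius Ω ≤ r :=
  csInf_le ⟨0, fun _ ⟨_, h⟩ => h.1⟩ ⟨z, h⟩

/-- Compact sets without a common point have a positive optimal radius. -/
theorem optRadius_pos [NeZero n] (hc : ∀ i, IsCompact (Ω i)) (hne : ∀ i, (Ω i).Nonempty)
    (hempty : (⋂ i, Ω i) = ∅) {z : EuclideanSpace ℝ (Fin d)} {r : ℝ} (hr : Feasible Ω z r) :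
    0 < optRadius Ω := by
  -- The sum of the distances attains its minimum on the compact set `Ω 0`, and a zero there would
  -- be a common point. A feasible radius `r'` gives a point of `Ω 0` with sum at most `2 n r'`,
  -- hence a positive lower bound for all such radii.
  set f : EuclideanSpace ℝ (Fin d) → ℝ := fun x => ∑ i, Metric.infDist x (Ω i) with hf
  have hcont : Continuous f := continuous_finsetSum _ fun i _ => Metric.continuous_infDist_pt _
  obtain ⟨x, hx, hmin⟩ := (hc 0).exists_isMinOn (hne 0) hcont.continuousOn
  have hpos : 0 < f x := by
    refine (Finset.sum_nonneg fun i _ => Metric.infDist_nonneg).lt_of_ne fun h0 => ?_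
    have h1 := (Finset.sum_eq_zero_iff_of_nonneg fun i _ => Metric.infDist_nonneg).1 h0.symm
    have : x ∈ ⋂ i, Ω i := mem_iInter.2 fun i =>
      ((hc i).isClosed.mem_iff_infDist_zero (hne i)).2 (h1 i (Finset.mem_univ i))
    rw [hempty] at this
    exact this
  have hn : (0 : ℝ) < n := by exact_mod_cast NeZero.pos n
  refine lt_of_lt_of_le (b := f x / (n * 2)) (by positivity) (le_csInf ⟨r, z, hr⟩ ?_)
  rintro r' ⟨z', h0, v, hv⟩
  have h1 : f x ≤ f (v 0) := hmin (hv 0).1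
  have h2 : f (v 0) ≤ ∑ _i : Fin n, 2 * r' := by
    refine Finset.sum_le_sum fun i _ => (Metric.infDist_le_dist_of_mem (hv i).1).trans ?_
    have h3 := dist_triangle_left (v 0) (v i) z'
    rw [dist_eq_norm z', dist_eq_norm z'] at h3
    linarith [(hv 0).2, (hv i).2]
  rw [Finset.sum_const, Finset.card_univ, Fintype.card_fin, nsmul_eq_mul] at h2
  rw [div_le_iff₀ (by positivity)]
  linarith

theorem norm_bestCenter_sub_le {E : Type*} [NormedAddCommGroup E] [InnerProductSpace ℝ E] (o S : E)
    {ρ : ℝ} (hρ : 0 ≤ ρ) : ‖bestCenter o ρ S - o‖ ≤ 3 * ρ := by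
  rw [bestCenter, sub_sub_cancel_left, norm_neg, norm_smul,
    Real.norm_of_nonneg (by positivity)]
  rcases eq_or_ne ‖S‖ 0 with h | h
  · rw [h, mul_zero]; positivity
  · rw [div_mul_cancel₀ _ h]

/-- By Cauchy–Schwarz, a linear form on a ball is smallest at the boundary point opposite to its
gradient. If `S = 0`, the formula yields the midpoint `o`, which is as good as any other. -/
theorem inner_bestCenter_le {E : Type*} [NormedAddCommGroup E] [InnerProductSpace ℝ E] {o S x : E}
    {ρ : ℝ} (hx : ‖x - o‖ ≤ 3 * ρ) : inner ℝ S (bestCenter o ρ S) ≤ inner ℝ S x := by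
  have h1 : inner ℝ S (bestCenter o ρ S) = inner ℝ S o - 3 * ρ * ‖S‖ := by
    rw [bestCenter, inner_sub_right, inner_smul_right, real_inner_self_eq_norm_sq]
    rcases eq_or_ne S 0 with rfl | h
    · simp
    · have := norm_pos_iff.2 h
      field_simp
  have h2 := real_inner_le_norm S (o - x)
  rw [inner_sub_right, norm_sub_rev] at h2
  have h3 := mul_le_mul_of_nonneg_left hx (norm_nonneg S)
  rw [h1]
  linarith

/-- The weighted payoff separates into a term for the center and one for each group. Replacing both
best responses by the center and witnesses of a nearly optimal ball can only increase it, and for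
those Cauchy–Schwarz bounds each inner product by the radius times `‖G i‖`. -/
theorem sum_bestResponse_le {η ρ : ℝ} (hη : 0 ≤ η) {o : EuclideanSpace ℝ (Fin d)}
    (hn : 0 < n) (hball : ∀ i, Ω i ⊆ Metric.closedBall o ρ)
    (hlt : optRadius Ω < 2 * ρ) (hfeas : ∃ r z, Feasible Ω z r)
    (G v : Fin n → EuclideanSpace ℝ (Fin d))
    (hv : ∀ i, ∀ x ∈ Ω i, inner ℝ (G i) x ≤ inner ℝ (G i) (v i)) :
    ∑ i, Real.sinh (η * ‖G i‖) / ‖G i‖ *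
      inner ℝ (G i) (bestCenter o ρ (∑ i, weighted η (G i)) - v i) ≤
      optRadius Ω * ∑ i, Real.sinh (η * ‖G i‖) := by
  set S := ∑ i, weighted η (G i) with hS
  set w : Fin n → ℝ := fun i => Real.sinh (η * ‖G i‖) / ‖G i‖ with hw
  have hsinh : ∀ i, 0 ≤ Real.sinh (η * ‖G i‖) := fun i =>
    Real.sinh_nonneg_iff.2 (by positivity)
  have hw0 : ∀ i, 0 ≤ w i := fun i => div_nonneg (hsinh i) (norm_nonneg _)
  have hwG : ∀ i, w i * ‖G i‖ = Real.sinh (η * ‖G i‖) := by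
    intro i
    rcases eq_or_ne ‖G i‖ 0 with h | h
    · simp [h]
    · exact div_mul_cancel₀ _ h
  have hsplit : ∀ (x : EuclideanSpace ℝ (Fin d)) (u : Fin n → EuclideanSpace ℝ (Fin d)),
      ∑ i, w i * inner ℝ (G i) (x - u i) = inner ℝ S x - ∑ i, w i * inner ℝ (G i) (u i) := by
    intro x u
    simp only [inner_sub_right, mul_sub, Finset.sum_sub_distrib, hS, sum_inner, weighted,
      inner_smul_left, hw, conj_trivial]
  -- Attainment of the infimum is not needed: the bound is proved for every slightly larger `r'`,
  -- and `r'` then tends to the optimum.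
  have key : ∀ r' ∈ Ioo (optRadius Ω) (2 * ρ),
      ∑ i, w i * inner ℝ (G i) (bestCenter o ρ S - v i) ≤ r' * ∑ i, Real.sinh (η * ‖G i‖) := by
    rintro r' ⟨hr1, hr2⟩
    obtain ⟨r0, z0, hr0⟩ := hfeas
    obtain ⟨r, ⟨z, h0, u, hu⟩, hr⟩ := exists_lt_of_csInf_lt
      (⟨r0, z0, hr0⟩ : {r | ∃ z, Feasible Ω z r}.Nonempty) hr1
    -- The competing center is within `r' < 2ρ` of a point of the ball of radius `ρ`; this is why
    -- the center player needs radius `3ρ`.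
    have hz : ‖z - o‖ ≤ 3 * ρ := by
      have h1 := mem_closedBall_iff_norm.1 (hball ⟨0, hn⟩ (hu ⟨0, hn⟩).1)
      have h2 := norm_add_le (z - u ⟨0, hn⟩) (u ⟨0, hn⟩ - o)
      rw [sub_add_sub_cancel] at h2
      linarith [(hu ⟨0, hn⟩).2]
    calc ∑ i, w i * inner ℝ (G i) (bestCenter o ρ S - v i)
        ≤ ∑ i, w i * inner ℝ (G i) (z - u i) := by
          rw [hsplit, hsplit]
          refine sub_le_sub (inner_bestCenter_le hz) (Finset.sum_le_sum fun i _ => ?_)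
          exact mul_le_mul_of_nonneg_left (hv i _ (hu i).1) (hw0 i)
      _ ≤ ∑ i, r' * Real.sinh (η * ‖G i‖) := by
          refine Finset.sum_le_sum fun i _ => ?_
          have h1 := (real_inner_le_norm (G i) (z - u i)).trans
            (mul_le_mul_of_nonneg_left ((hu i).2.trans hr.le) (norm_nonneg _))
          calc _ ≤ w i * (‖G i‖ * r') := mul_le_mul_of_nonneg_left h1 (hw0 i)
            _ = _ := by rw [← mul_assoc, hwG, mul_comm]
      _ = _ := by rw [Finset.mul_sum]
  have htend : Filter.Tendsto (fun r' : ℝ => r' * ∑ i, Real.sinh (η * ‖G i‖))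
      (nhdsWithin (optRadius Ω) (Ioi (optRadius Ω)))
      (nhds (optRadius Ω * ∑ i, Real.sinh (η * ‖G i‖))) :=
    ((continuous_id.mul continuous_const).tendsto _).mono_left nhdsWithin_le_nhds
  exact ge_of_tendsto htend (Filter.mem_of_superset (Ioo_mem_nhdsGT hlt) key)

theorem inner_le_of_mem_convexHull {E : Type*} [NormedAddCommGroup E] [InnerProductSpace ℝ E]
    {A : Set E} {g : E} {c : ℝ} (h : ∀ x ∈ A, inner ℝ g x ≤ c) {x : E} (hx : x ∈ convexHull ℝ A) :
    inner ℝ g x ≤ c :=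
  convexHull_min h (convex_halfSpace_le (innerₛₗ ℝ g).isLinear c) hx

end Geometry

end SIB

/-! ### Number of rounds, correctness, and total time -/

namespace SIB

open RealRAM

theorem log_two_mul_le {n : ℕ} (hn : 1 < n) :
    Real.log (2 * n) ≤ 2 * (Nat.clog 2 n : ℝ) := by
  have h1 : (n : ℝ) ≤ 2 ^ Nat.clog 2 n := by exact_mod_cast Nat.le_pow_clog (by norm_num) n
  have h0 : (0 : ℝ) < n := by exact_mod_cast (by lia : 0 < n)
  have h2 := Real.log_le_log h0 h1
  rw [Real.log_pow] at h2
  rw [Real.log_mul (by norm_num) h0.ne']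
  have h3 : (1 : ℝ) ≤ Nat.clog 2 n := by exact_mod_cast Nat.clog_pos (by norm_num) hn
  have h4 := Real.log_two_lt_d9
  have h5 := Real.log_two_gt_d9
  nlinarith

theorem clog_le_log {n : ℕ} (hn : 1 < n) : (Nat.clog 2 n : ℝ) ≤ 3 * Real.log n := by
  have h1 : (2 : ℝ) ^ (Nat.clog 2 n - 1) ≤ n := by
    exact_mod_cast (Nat.pow_pred_clog_lt_self (b := 2) (by norm_num) hn).le
  have h2 := Real.log_le_log (by positivity) h1
  have hpos : 1 ≤ Nat.clog 2 n := Nat.clog_pos (by norm_num) hn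
  rw [Real.log_pow, Nat.cast_sub hpos] at h2
  have h3 : Real.log 2 ≤ Real.log n :=
    Real.log_le_log (by norm_num) (by exact_mod_cast hn)
  have h5 := Real.log_two_gt_d9
  push_cast at h2
  have h6 : (1 : ℝ) ≤ Nat.clog 2 n := by exact_mod_cast hpos
  nlinarith

/-- The bound on the number of rounds. -/
theorem rounds_lt {ε r ρ ℓ t m : ℝ} (hε : 0 < ε) (hr : 0 < r) (hℓ : 1 ≤ ℓ) (ht : 0 ≤ t)
    (hm : t * r ≤ m) (h : ε * m < 40 * ρ * √(ℓ * (ℓ + t))) :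
    t < 3200 * ρ ^ 2 * ℓ / (ε * r) ^ 2 + ℓ := by
  have h1 : ε * (t * r) < 40 * ρ * √(ℓ * (ℓ + t)) :=
    (mul_le_mul_of_nonneg_left hm hε.le).trans_lt h
  have h2 : (ε * (t * r)) ^ 2 < (40 * ρ * √(ℓ * (ℓ + t))) ^ 2 :=
    pow_lt_pow_left₀ h1 (by positivity) (by norm_num)
  rw [mul_pow (40 * ρ), Real.sq_sqrt (by positivity)] at h2
  -- For `t ≥ ℓ`, the sum `ℓ + t` is at most `2t`, and one factor `t` cancels; the constant is `3200
  -- = 2 * 40²`.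
  rcases lt_or_ge t ℓ with hlt | hge
  · have : 0 ≤ 3200 * ρ ^ 2 * ℓ / (ε * r) ^ 2 := by positivity
    linarith
  · have ht0 : 0 < t := by linarith
    have h3 : t < 3200 * ρ ^ 2 * ℓ / (ε * r) ^ 2 := by
      rw [lt_div_iff₀ (by positivity)]
      have h4 : t * (t * (ε * r) ^ 2) < t * (3200 * ρ ^ 2 * ℓ) := by
        have : (40 * ρ) ^ 2 * (ℓ * (ℓ + t)) ≤ (40 * ρ) ^ 2 * (ℓ * (t + t)) := by gcongr
        nlinarith
      exact lt_of_mul_lt_mul_left h4 ht0.le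
    linarith

section Correctness

variable {n d : ℕ}

/-- The invariant of the main loop on the mathematical side. -/
structure Progress (Ω : Fin n → Set (EuclideanSpace ℝ (Fin d))) (ℓ L : ℝ) (t : ℕ)
    (G : ℕ → EuclideanSpace ℝ (Fin d)) (Z : EuclideanSpace ℝ (Fin d)) : Prop where
  bound : PotentialBound ℓ L (optRadius Ω) t fun i : Fin n => G i
  zero : t = 0 → ∀ i : Fin n, G i = 0
  mem : ∀ i : Fin n, ∃ v ∈ Ω i, Z - G i = (t : ℝ) • v

variable {Ω : Fin n → Set (EuclideanSpace ℝ (Fin d))}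

/-- The difference between the mean center and the mean point of group `i` is `G i / t`, and the
mean point is the one provided by `mem`. -/
theorem Progress.feasible {ℓ L : ℝ} {t : ℕ} {G : ℕ → EuclideanSpace ℝ (Fin d)}
    {Z : EuclideanSpace ℝ (Fin d)} (h : Progress Ω ℓ L t G Z) (ht : 0 < t) {m : ℝ} (hm0 : 0 ≤ m)
    (hm : ∀ k < n, ‖G k‖ ≤ m) : Feasible Ω ((t : ℝ)⁻¹ • Z) (m / t) := by
  choose v hv hZ using h.mem
  have ht' : (0 : ℝ) < t := by exact_mod_cast ht
  refine ⟨by positivity, v, fun i => ⟨hv i, ?_⟩⟩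
  have : (t : ℝ)⁻¹ • Z - v i = (t : ℝ)⁻¹ • G i := by
    rw [← sub_add_cancel Z (G i), hZ i, smul_add, inv_smul_smul₀ ht'.ne', add_sub_cancel_left]
  rw [this, norm_smul, Real.norm_of_nonneg (by positivity), inv_mul_eq_div]
  gcongr
  exact hm i i.2

/-- The width is `4ρ`, since the center is within `3ρ` and each point within `ρ` of `o`. Membership
of the running mean in `Ω i` is preserved by convexity. -/
theorem Progress.step {ℓ ρ : ℝ} {t : ℕ} {G : ℕ → EuclideanSpace ℝ (Fin d)}
    {Z : EuclideanSpace ℝ (Fin d)} (h : Progress Ω ℓ (4 * ρ) t G Z) (hℓ : 1 ≤ ℓ) (hρ : 0 < ρ)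
    (hn : 0 < n) {o : EuclideanSpace ℝ (Fin d)} (hball : ∀ i, Ω i ⊆ Metric.closedBall o ρ)
    (hconv : ∀ i, Convex ℝ (Ω i)) (hpos : 0 ≤ optRadius Ω)
    (hlt : optRadius Ω < 2 * ρ) (hfeas : ∃ r z, Feasible Ω z r)
    {v : ℕ → EuclideanSpace ℝ (Fin d)} (hv : ∀ i : Fin n, v i ∈ Ω i)
    (hmax : ∀ i : Fin n, ∀ x ∈ Ω i, inner ℝ (G i) x ≤ inner ℝ (G i) (v i))
    {z : EuclideanSpace ℝ (Fin d)}
    (hz : z = bestCenter o ρ (∑ k ∈ Finset.range n, weighted (rate ℓ (4 * ρ) t) (G k))) :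
    Progress Ω ℓ (4 * ρ) (t + 1) (fun k => G k + (z - v k)) (Z + z) := by
  have hη : 0 < rate ℓ (4 * ρ) t := rate_pos hℓ (by positivity) t.cast_nonneg
  refine ⟨?_, fun h => absurd h t.succ_ne_zero, fun i => ?_⟩
  · refine h.bound.step hℓ (by positivity) hpos (g := fun i : Fin n => z - v i) (fun i => ?_) ?_
    · have h1 : ‖z - o‖ ≤ 3 * ρ := by rw [hz]; exact norm_bestCenter_sub_le o _ hρ.le
      have h2 := mem_closedBall_iff_norm'.1 (hball i (hv i))
      have h3 := norm_add_le (z - o) (o - v i)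
      rw [sub_add_sub_cancel] at h3
      linarith
    · rw [hz, ← Fin.sum_univ_eq_sum_range fun k => weighted (rate ℓ (4 * ρ) t) (G k)]
      exact sum_bestResponse_le hη.le hn hball hlt hfeas (fun i => G i) (fun i => v i) hmax
  · obtain ⟨u, hu, hZ⟩ := h.mem i
    have ht : (0 : ℝ) < (t : ℝ) + 1 := by positivity
    refine ⟨((t : ℝ) / (t + 1)) • u + (1 / ((t : ℝ) + 1)) • v i,
      hconv i hu (hv i) (by positivity) (by positivity) (by field_simp), ?_⟩
    rw [show Z + z - (G i + (z - v i)) = (Z - G i) + v i by abel, hZ, smul_add, smul_smul,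
      smul_smul]
    push_cast
    rw [mul_div_cancel₀ _ ht.ne', mul_one_div_cancel ht.ne', one_smul]

/-- The stopping test makes the error `5 * (4ρ) √(ℓ (ℓ + t))` at most `(ε / 2) m`, so `(1 - ε / 2) m
≤ t r*`. The claim follows from `(1 + ε) (1 - ε / 2) ≥ 1`, which holds for `0 ≤ ε ≤ 1`. -/
theorem Progress.approx {ℓ ρ ε : ℝ} {t : ℕ} {G : ℕ → EuclideanSpace ℝ (Fin d)}
    {Z : EuclideanSpace ℝ (Fin d)} (h : Progress Ω ℓ (4 * ρ) t G Z) (hℓ : 1 ≤ ℓ) (hρ : 0 < ρ)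
    (hlog : Real.log (2 * n) ≤ 2 * ℓ) (hpos : 0 ≤ optRadius Ω) (hε : 0 < ε) (hε1 : ε ≤ 1) {m : ℝ}
    (hm0 : 0 ≤ m) (hm : ∀ k < n, ‖G k‖ ≤ m)
    (hmle : ∀ c : ℝ, 0 ≤ c → (∀ k < n, ‖G k‖ ≤ c) → m ≤ c)
    (hend : 40 * ρ * √(ℓ * (ℓ + t)) ≤ ε * m) :
    IsApprox Ω ε ((t : ℝ)⁻¹ • Z) (m / t) := by
  -- Before the first round all gains vanish while the left side of `hend` is positive, so the loop
  -- cannot stop there.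
  have ht : 0 < t := by
    by_contra h0
    obtain rfl : t = 0 := by lia
    have hm' : m ≤ 0 := hmle 0 le_rfl fun k hk => by rw [h.zero rfl ⟨k, hk⟩, norm_zero]
    have : 0 < 40 * ρ * √(ℓ * (ℓ + (0 : ℕ))) := by
      have : 0 < √(ℓ * (ℓ + (0 : ℕ))) := Real.sqrt_pos.2 (by push_cast; nlinarith)
      positivity
    nlinarith
  have ht' : (0 : ℝ) < t := by exact_mod_cast ht
  refine ⟨h.feasible ht hm0 hm, ?_⟩
  have hle : m ≤ t * optRadius Ω + 5 * (4 * ρ) * √(ℓ * (ℓ + t)) := by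
    refine hmle _ (by positivity) fun k hk => ?_
    exact h.bound.norm_le hℓ (by positivity) (by simpa using hlog) ⟨k, hk⟩
  rw [div_le_iff₀ ht']
  have h1 : (1 - ε / 2) * m ≤ t * optRadius Ω := by linarith
  have h2 : 0 ≤ t * optRadius Ω := by positivity
  nlinarith [mul_le_mul_of_nonneg_left h1 (by linarith : 0 ≤ 1 + ε),
    mul_nonneg (mul_nonneg hε.le (sub_nonneg.2 hε1)) hm0]

end Correctness

theorem runs_sibCmd {n d : ℕ} {P : Fin n → Finset (EuclideanSpace ℝ (Fin d))} {ε : ℝ} {s : Store}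
    (hn : 1 < n) (hP : ∀ i, (P i).Nonempty) (hempty : (⋂ i, polytopes P i) = ∅) (hε : 0 < ε)
    (hε1 : ε ≤ 1) (hs : Encodes P ε s) :
    ∃ (s' : Store) (t : ℕ), Exec sibCmd s s' t ∧
      IsApprox (polytopes P) ε (outCenter d s') (outRadius s') ∧
      (t : ℝ) ≤ 10 ^ 7 * (ratio (polytopes P) ^ 2 * ((totalNnz P : ℝ) + n * d) *
          Real.log n / ε ^ 2) ∧ 0 < optRadius (polytopes P) := by
  obtain ⟨q, hL, hq, hE, hM⟩ := hs.exists_layout hP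
  have hsε : s.rvar 0 = ε := hs.2.2.1
  have : NeZero n := ⟨by lia⟩
  set Ω := polytopes P with hΩ
  set r := optRadius Ω with hr
  set ℓ := Nat.clog 2 n with hℓ
  have hM0 : 0 < s.narr 0 n := by
    have h1 := hL.group_lt 0 (by lia)
    have h2 := hL.group_mono (i := 1) (by lia) le_rfl
    lia
  have hmemP : ∀ (i : Fin n) p, s.narr 0 i ≤ p → p < s.narr 0 ((i : ℕ) + 1) → q p ∈ P i := by
    intro i p h1 h2
    have : q p ∈ (P i : Set (EuclideanSpace ℝ (Fin d))) := by
      rw [← hq i]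
      exact ⟨p, ⟨h1, h2⟩, rfl⟩
    exact this
  have hPmem : ∀ (i : Fin n), ∀ x ∈ P i, ∃ p, (s.narr 0 i ≤ p ∧ p < s.narr 0 ((i : ℕ) + 1)) ∧
      q p = x := by
    intro i x hx
    have : x ∈ q '' Ico (s.narr 0 i) (s.narr 0 ((i : ℕ) + 1)) := by rw [hq i]; exact hx
    obtain ⟨p, hp, rfl⟩ := this
    exact ⟨p, hp, rfl⟩
  have hgroup : ∀ i : Fin n, s.narr 0 ((i : ℕ) + 1) ≤ s.narr 0 n := fun i =>
    hL.group_mono i.2 le_rfl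
  have hcompact : ∀ i, IsCompact (Ω i) := fun i => (P i).finite_toSet.isCompact_convexHull ℝ
  have hconv : ∀ i, Convex ℝ (Ω i) := fun i => convex_convexHull ℝ _
  have hsub : ∀ i, (P i : Set (EuclideanSpace ℝ (Fin d))) ⊆ Ω i := fun i => subset_convexHull ℝ _
  have hne : ∀ i, (Ω i).Nonempty := fun i => (Finset.coe_nonempty.2 (hP i)).mono (hsub i)
  have hmain : ∀ ρ : ℝ, (∀ p < s.narr 0 n, ‖q p - q 0‖ ≤ ρ) → ∀ i, Ω i ⊆ Metric.closedBall (q 0) ρ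
      := by
    intro ρ hρ i
    refine convexHull_min (fun x hx => ?_) (convex_closedBall _ _)
    obtain ⟨p, ⟨-, hp⟩, rfl⟩ := hPmem i x hx
    exact mem_closedBall_iff_norm.2 (hρ p (hp.trans_le (hgroup i)))
  have hfeas : ∀ ρ : ℝ, (∀ p < s.narr 0 n, ‖q p - q 0‖ ≤ ρ) → Feasible Ω (q 0) ρ := by
    intro ρ hρ
    choose v hv using hne
    refine ⟨(norm_nonneg _).trans (hρ 0 hM0), v, fun i => ⟨hv i, ?_⟩⟩
    exact mem_closedBall_iff_norm'.1 (hmain ρ hρ i (hv i))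
  have hdiam : ∀ p < s.narr 0 n, ‖q p - q 0‖ ≤ diameter Ω := by
    intro p hp
    have hall : ∀ p < s.narr 0 n, q p ∈ convexHull ℝ (⋃ i, Ω i) := by
      have hcov : ∀ k ≤ n, ∀ p < s.narr 0 k, ∃ i : Fin n, q p ∈ P i := by
        intro k
        induction k with
        | zero => intro _ p hp; rw [hL.group_zero] at hp; exact absurd hp p.not_lt_zero
        | succ k ih =>
          intro hk p hp
          rcases lt_or_ge p (s.narr 0 k) with h | h
          · exact ih (by lia) p h
          · exact ⟨⟨k, hk⟩, hmemP ⟨k, hk⟩ p h hp⟩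
      intro p hp
      obtain ⟨i, hi⟩ := hcov n le_rfl p hp
      exact subset_convexHull ℝ _ (mem_iUnion.2 ⟨i, hsub i hi⟩)
    rw [← dist_eq_norm]
    refine Metric.dist_le_diam_of_mem ?_ (hall p hp) (hall 0 hM0)
    rw [isBounded_convexHull]
    exact (Bornology.isBounded_iUnion.2 fun i => (hcompact i).isBounded)
  have hr0 : 0 < r := optRadius_pos hcompact hne hempty (hfeas _ hdiam)
  -- In dimension zero all sets coincide, contrary to `r > 0`. Positivity of `d` lets `n * d` absorb
  -- terms of order `n` and constants in the running time.
  have hd : 1 ≤ d := by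
    by_contra h0
    obtain rfl : d = 0 := by lia
    have : r ≤ 0 := optRadius_le (hfeas 0 fun p _ => by
      rw [Subsingleton.elim (q p - q 0) 0, norm_zero])
    linarith
  have hℓ1 : (1 : ℝ) ≤ ℓ := by exact_mod_cast Nat.clog_pos (by norm_num) hn
  -- the number of rounds
  set X : ℝ := ratio Ω ^ 2 / ε ^ 2 with hX
  have hrD : r ≤ diameter Ω := optRadius_le (hfeas _ hdiam)
  have hratio : 1 ≤ ratio Ω := (one_le_div hr0).2 hrD
  have hX1 : 1 ≤ X := by
    rw [hX, one_le_div (by positivity)]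
    exact pow_le_pow_left₀ hε.le (hε1.trans hratio) 2
  -- The bound of `rounds_lt`, with the radius `ρ` measured during the run replaced by its upper
  -- bound `D`, which depends only on the input.
  set K : ℕ := ⌈3200 * X * ℓ + ℓ⌉₊ + 1 with hK
  set c : ℕ := 46 * s.narr 1 (s.narr 0 n) + 64 * s.narr 0 n + 75 * (n * d) + 98 * n +
      100 * d + 106 with hc
  have H : Runs sibCmd s (80 * d + 50 * s.narr 1 (s.narr 0 n) + 60 * s.narr 0 n + 20 * (n * d) +
      20 * n + 12 * ℓ + 120 + ((c + 18) * K + 18 + (20 * d + 20)))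
      fun s' => IsApprox Ω ε (outCenter d s') (outRadius s') := by
    refine (runs_initCmd hL hM0).seq ?_
    rintro s1 ⟨hρle, ⟨p0, hp0, hρeq⟩, hs1⟩
    set ρ := s1.rvar 2 with hρ
    have hball := hmain ρ hρle
    have hrρ : r ≤ ρ := optRadius_le (hfeas ρ hρle)
    have hρ0 : 0 < ρ := hr0.trans_le hrρ
    have hρD : ρ ≤ diameter Ω := hρeq ▸ hdiam p0 hp0
    have hprog0 : Progress Ω ℓ (4 * ρ) 0 0 0 := by
      refine ⟨potentialBound_zero hℓ1 (by positivity), fun _ _ => rfl, fun i => ?_⟩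
      obtain ⟨v, hv⟩ := hne i
      exact ⟨v, hv, by simp⟩
    have htest : ∀ (t : ℕ) (G : ℕ → EuclideanSpace ℝ (Fin d)) Z s2,
        RoundState n q s ℓ ρ t G Z s2 →
        (BExp.holds s2 (.rlt (.mul (.var 0) (.var 1)) (.mul (.mul (.ofNat (.const 40)) (.var 2))
          (.sqrt (.mul (.ofNat (.var 2)) (.ofNat (.add (.var 2) (.var 9))))))) ↔
          ε * s2.rvar 1 < 40 * ρ * √(ℓ * (ℓ + t))) := by
      intro t G Z s2 h
      simp only [BExp.holds, RExp.eval, NExp.eval, h.log_eq, h.rounds_eq, h.radius_eq,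
        h.same.rvar 0 (by decide), hsε]
      push_cast
      rfl
    have hmax0 : ∀ (t : ℕ) (G : ℕ → EuclideanSpace ℝ (Fin d)) Z s2,
        RoundState n q s ℓ ρ t G Z s2 → 0 ≤ s2.rvar 1 := fun t G Z s2 h =>
      (norm_nonneg _).trans (h.le_max 0 (by lia))
    refine (Runs.loop (k := 0) (K := K) (T := fun k => (c + 18) * k)
      (I := fun k s' => k ≤ K ∧ ∃ G Z, RoundState n q s ℓ ρ k G Z s' ∧ Progress Ω ℓ (4 * ρ) k G Z)
      ?_ ?_ ?_ ?_).seq ?_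
    · rintro k s2 ⟨-, G, Z, hG, hprog⟩ hb
      rw [htest k G Z s2 hG] at hb
      -- The current averages already form an intersecting ball, so its radius is at least the
      -- optimum. This lower bound on the largest gain forces the stopping test to succeed.
      have hkr : k * r ≤ s2.rvar 1 := by
        rcases Nat.eq_zero_or_pos k with rfl | hk
        · simpa using hmax0 _ _ _ _ hG
        · have hk' : (0 : ℝ) < k := by exact_mod_cast hk
          have := optRadius_le (hprog.feasible hk (hmax0 _ _ _ _ hG) hG.le_max)
          rw [le_div_iff₀ hk'] at this
          linarith
      have hlt := rounds_lt hε hr0 hℓ1 k.cast_nonneg hkr hb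
      have hkK : k < K := by
        have h1 : 3200 * ρ ^ 2 * ℓ / (ε * r) ^ 2 ≤ 3200 * X * ℓ := by
          have : ρ ^ 2 / (ε * r) ^ 2 ≤ X := by
            rw [hX, ratio, div_pow, div_div, ← mul_pow, mul_comm r]
            gcongr
          calc _ = 3200 * (ρ ^ 2 / (ε * r) ^ 2) * ℓ := by ring
            _ ≤ _ := by gcongr
        have h2 := Nat.le_ceil (3200 * X * ℓ + ℓ)
        have h3 : (k : ℝ) < ⌈3200 * X * ℓ + ℓ⌉₊ := by linarith
        have h4 : k < ⌈3200 * X * ℓ + ℓ⌉₊ := by exact_mod_cast h3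
        lia
      refine ⟨hkK, c, ?_, (runs_roundCmd hL hG).mono le_rfl ?_⟩
      · simp only [BExp.cost, RExp.cost, NExp.cost]
        rw [Nat.mul_succ]
        lia
      rintro s3 ⟨p, hp, hG'⟩
      refine ⟨hkK, _, _, hG', hprog.step hℓ1 hρ0 (by lia) hball hconv hr0.le (by linarith)
        ⟨_, _, hfeas ρ hρle⟩ (v := fun k => q (p k)) ?_ ?_ rfl⟩
      · exact fun i => hsub i (hmemP i _ (hp i i.2).1.1 (hp i i.2).1.2)
      · intro i x hx
        refine inner_le_of_mem_convexHull (fun y hy => ?_) hx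
        obtain ⟨p', ⟨h1, h2⟩, rfl⟩ := hPmem i y hy
        exact (hp i i.2).2 p' h1 h2
    · rintro k s2 ⟨hk, -⟩ -
      exact Nat.mul_le_mul_left _ hk
    · exact ⟨Nat.zero_le _, 0, 0, hs1, hprog0⟩
    · simp only [BExp.cost, RExp.cost, NExp.cost]; lia
    · rintro s2 ⟨k, ⟨-, G, Z, hG, hprog⟩, hb⟩
      rw [htest k G Z s2 hG, not_lt] at hb
      refine (runs_outputCmd ((hL.of_agree hG.same).nvar_one)).mono le_rfl ?_
      rintro s3 ⟨h1, h2⟩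
      rw [h1, h2, hG.rounds_eq, hG.center_eq]
      exact hprog.approx hℓ1 hρ0 (log_two_mul_le hn) hr0.le hε hε1 (hmax0 _ _ _ _ hG) hG.le_max
        hG.max_le hb
  obtain ⟨s', t, hexec, ht, happrox⟩ := H
  refine ⟨s', t, hexec, happrox, ?_, hr0⟩
  set W : ℝ := (totalNnz P : ℝ) + n * d with hW
  have hnd : n ≤ n * d := Nat.le_mul_of_pos_right n hd
  have hdn : d ≤ n * d := Nat.le_mul_of_pos_left d (by lia)
  have hc' : c ≤ 600 * (totalNnz P + n * d) := by rw [hc, hE]; lia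
  have ht' : t ≤ 500 * (totalNnz P + n * d) + 12 * ℓ + (700 * (totalNnz P + n * d)) * K := by
    have h1 : (c + 18) * K ≤ (700 * (totalNnz P + n * d)) * K := Nat.mul_le_mul_right _ (by lia)
    rw [hE] at ht
    lia
  have htR : (t : ℝ) ≤ 500 * W + 12 * ℓ + (700 * W) * K := by rw [hW]; exact_mod_cast ht'
  have hKR : (K : ℝ) ≤ 3203 * X * ℓ := by
    have h1 := (Nat.ceil_lt_add_one (by positivity : (0 : ℝ) ≤ 3200 * X * ℓ + ℓ)).le
    rw [hK]
    push_cast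
    have h2 : (ℓ : ℝ) ≤ X * ℓ := le_mul_of_one_le_left (by positivity) hX1
    nlinarith
  have hW1 : 1 ≤ W := by
    have : (1 : ℝ) ≤ n * d := by exact_mod_cast (by lia : 1 ≤ n * d)
    have : (0 : ℝ) ≤ totalNnz P := Nat.cast_nonneg _
    rw [hW]; linarith
  have hXℓ : (1 : ℝ) ≤ X * ℓ := by nlinarith
  have hWK : W * K ≤ W * (3203 * X * ℓ) := by gcongr
  have h1 : W ≤ W * (X * ℓ) := le_mul_of_one_le_right (by linarith) hXℓ
  have h2 : (ℓ : ℝ) ≤ W * (X * ℓ) := by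
    have : (ℓ : ℝ) ≤ X * ℓ := le_mul_of_one_le_left (by positivity) hX1
    nlinarith
  have h3 : W * (X * ℓ) ≤ W * (X * (3 * Real.log n)) := by
    gcongr
    exact clog_le_log hn
  calc (t : ℝ) ≤ 500 * W + 12 * ℓ + (700 * W) * K := htR
    _ ≤ (500 + 12 + 700 * 3203) * (W * (X * ℓ)) := by linarith
    _ ≤ (500 + 12 + 700 * 3203) * (W * (X * (3 * Real.log n))) := by gcongr
    _ ≤ 10 ^ 7 * (W * (X * Real.log n)) := by
      have : 0 ≤ W * (X * Real.log n) := by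
        have := Real.log_nonneg (by exact_mod_cast hn.le : (1 : ℝ) ≤ n)
        positivity
      linarith
    _ = _ := by rw [hX]; ring

end SIB

namespace SIB

/-! ### Enclosing balls, polytope distance, and segments -/

section SpecialCases

variable {n d : ℕ}

theorem nnz_le (v : EuclideanSpace ℝ (Fin d)) : nnz v ≤ d := by
  rw [nnz_eq_card]
  exact (Finset.card_le_univ _).trans (by simp)

theorem totalNnz_le {P : Fin n → Finset (EuclideanSpace ℝ (Fin d))} {k : ℕ}
    (h : ∀ i, (P i).card ≤ k) : totalNnz P ≤ k * (n * d) := by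
  have h1 : ∀ i, ∑ p ∈ P i, nnz p ≤ k * d := fun i =>
    (Finset.sum_le_card_nsmul _ _ d fun p _ => nnz_le p).trans
      (Nat.mul_le_mul_right d (h i))
  refine (Finset.sum_le_sum fun i _ => h1 i).trans (le_of_eq ?_)
  simp only [Finset.sum_const, Finset.card_univ, Fintype.card_fin, smul_eq_mul]
  ring

variable {P : Fin n → Finset (EuclideanSpace ℝ (Fin d))} {c : Fin n → EuclideanSpace ℝ (Fin d)}

theorem polytopes_singleton (h : ∀ i, P i = {c i}) (i : Fin n) : polytopes P i = {c i} := by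
  simp [polytopes, h i]

theorem feasible_singleton (h : ∀ i, P i = {c i}) {z : EuclideanSpace ℝ (Fin d)} {r : ℝ} :
    Feasible (polytopes P) z r ↔ 0 ≤ r ∧ ∀ i, ‖z - c i‖ ≤ r := by
  simp only [Feasible, polytopes_singleton h, mem_singleton_iff]
  refine and_congr_right fun _ => ⟨?_, fun hz => ⟨c, fun i => ⟨rfl, hz i⟩⟩⟩
  rintro ⟨v, hv⟩ i
  rw [← (hv i).1]
  exact (hv i).2

theorem optRadius_singleton (h : ∀ i, P i = {c i}) :
    optRadius (polytopes P) = enclosingRadius c := by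
  simp only [optRadius, enclosingRadius, feasible_singleton h, exists_and_left]

/-- Any two centers lie in a common ball, so their distance is at most twice its radius. Hence `R ≤
2` for enclosing balls, and the factor `R²` disappears from the time bound. -/
theorem diameter_singleton_le (h : ∀ i, P i = {c i}) (hr : ∃ r z, Feasible (polytopes P) z r) :
    diameter (polytopes P) ≤ 2 * optRadius (polytopes P) := by
  rw [← div_le_iff₀' (by norm_num)]
  obtain ⟨r0, z0, hr0⟩ := hr
  refine le_csInf ⟨r0, z0, hr0⟩ ?_
  rintro r ⟨z, hz⟩
  obtain ⟨h0, hz⟩ := (feasible_singleton h).1 hz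
  rw [div_le_iff₀' (by norm_num), diameter, convexHull_diam]
  refine Metric.diam_le_of_forall_dist_le (by positivity) fun x hx y hy => ?_
  simp only [polytopes_singleton h, mem_iUnion, mem_singleton_iff] at hx hy
  obtain ⟨i, rfl⟩ := hx
  obtain ⟨j, rfl⟩ := hy
  have := dist_triangle_left (c i) (c j) z
  rw [dist_eq_norm z, dist_eq_norm z] at this
  linarith [hz i, hz j]

theorem setDist_le_of_feasible {Ω : Fin n → Set (EuclideanSpace ℝ (Fin d))}
    {z : EuclideanSpace ℝ (Fin d)} {r : ℝ} (h : Feasible Ω z r) (i j : Fin n) :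
    setDist (Ω i) (Ω j) ≤ 2 * r := by
  obtain ⟨-, v, hv⟩ := h
  have hle : setDist (Ω i) (Ω j) ≤ ‖v i - v j‖ := by
    refine csInf_le ⟨0, ?_⟩ ⟨v i, (hv i).1, v j, (hv j).1, rfl⟩
    rintro _ ⟨x, -, y, -, rfl⟩
    exact norm_nonneg _
  have := dist_triangle_left (v i) (v j) z
  rw [dist_eq_norm z, dist_eq_norm z, dist_eq_norm] at this
  linarith [(hv i).2, (hv j).2]

/-- When only two sets occur, the midpoint of any `x` and `y` in them is the center of an
intersecting ball of radius `‖x - y‖ / 2`. -/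
theorem two_mul_optRadius_le {Ω : Fin n → Set (EuclideanSpace ℝ (Fin d))}
    (hne : ∀ i, (Ω i).Nonempty) {i j : Fin n} (hcover : ∀ k, k = i ∨ k = j) :
    2 * optRadius Ω ≤ setDist (Ω i) (Ω j) := by
  obtain ⟨x₀, hx₀⟩ := hne i
  obtain ⟨y₀, hy₀⟩ := hne j
  refine le_csInf ⟨_, x₀, hx₀, y₀, hy₀, rfl⟩ ?_
  rintro _ ⟨x, hx, y, hy, rfl⟩
  rw [← le_div_iff₀' (by norm_num)]
  refine optRadius_le (z := midpoint ℝ x y) ⟨by positivity, fun k => if k = i then x else y,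
    fun k => ?_⟩
  have h1 : ‖midpoint ℝ x y - x‖ = ‖x - y‖ / 2 := by
    rw [← dist_eq_norm, dist_midpoint_left, dist_eq_norm, Real.norm_ofNat, inv_mul_eq_div]
  have h2 : ‖midpoint ℝ x y - y‖ = ‖x - y‖ / 2 := by
    rw [← dist_eq_norm, dist_midpoint_right, dist_eq_norm, Real.norm_ofNat, inv_mul_eq_div]
  by_cases hk : k = i
  · subst hk
    simp only [if_true]
    exact ⟨hx, h1.le⟩
  · obtain rfl : k = j := (hcover k).resolve_left hk
    simp only [if_neg hk]
    exact ⟨hy, h2.le⟩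

end SpecialCases

end SIB

/-- There are one program `A` and one constant `C` such that, on every input, `A` halts with a
`(1 + ε)`-approximate smallest intersecting ball of the polytopes after at most
`C * R² (N + n d) log n / ε²` steps. The last three conjuncts are the cases of the smallest enclosing
ball, of the distance of two polytopes, and of the intersection radius of line segments. -/
theorem mainTheorem3 :
    ∃ (A : RealRAM.Cmd) (C : ℝ), ∀ (n d : ℕ) (P : Fin n → Finset (EuclideanSpace ℝ (Fin d)))
      (ε : ℝ) (s : RealRAM.Store),
      1 < n → (∀ i, (P i).Nonempty) → (⋂ i, SIB.polytopes P i) = ∅ → 0 < ε → ε ≤ 1 →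
      SIB.Encodes P ε s →
      ∃ (s' : RealRAM.Store) (t : ℕ), RealRAM.Exec A s s' t ∧
        SIB.IsApprox (SIB.polytopes P) ε (SIB.outCenter d s') (SIB.outRadius s') ∧
        (t : ℝ) ≤ C * (SIB.ratio (SIB.polytopes P) ^ 2 * ((SIB.totalNnz P : ℝ) + n * d) *
          Real.log n / ε ^ 2) ∧
        (∀ c : Fin n → EuclideanSpace ℝ (Fin d), (∀ i, P i = {c i}) →
          (∀ i, ‖SIB.outCenter d s' - c i‖ ≤ SIB.outRadius s') ∧
          SIB.outRadius s' ≤ (1 + ε) * SIB.enclosingRadius c ∧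
          (t : ℝ) ≤ C * ((n : ℝ) * d * Real.log n / ε ^ 2)) ∧
        (∀ i j : Fin n, i ≠ j → n = 2 →
          SIB.setDist (SIB.polytopes P i) (SIB.polytopes P j) ≤ 2 * SIB.outRadius s' ∧
          2 * SIB.outRadius s' ≤
            (1 + ε) * SIB.setDist (SIB.polytopes P i) (SIB.polytopes P j) ∧
          (t : ℝ) ≤ C * (SIB.ratio (SIB.polytopes P) ^ 2 * ((SIB.totalNnz P : ℝ) + d) / ε ^ 2)) ∧
        (∀ a b : Fin n → EuclideanSpace ℝ (Fin d),
          (∀ i, (P i : Set (EuclideanSpace ℝ (Fin d))) = {a i, b i}) →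
          SIB.IsApprox (fun i => segment ℝ (a i) (b i)) ε
            (SIB.outCenter d s') (SIB.outRadius s') ∧
          (t : ℝ) ≤ C * (SIB.ratio (SIB.polytopes P) ^ 2 * ((n : ℝ) * d) *
            Real.log n / ε ^ 2)) := by
  -- The general bound holds with `10 ^ 7`; the largest loss is the factor 8 for singletons, where
  -- `R² ≤ 4` and `N + n d ≤ 2 n d`.
  refine ⟨SIB.sibCmd, 10 ^ 8, ?_⟩
  intro n d P ε s hn hP hempty hε hε1 hs
  obtain ⟨s', t, hexec, happrox, ht, hpos⟩ := SIB.runs_sibCmd hn hP hempty hε hε1 hs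
  have hlog : 0 ≤ Real.log n := Real.log_nonneg (by exact_mod_cast hn.le)
  refine ⟨s', t, hexec, happrox, ht.trans ?_, ?_, ?_, ?_⟩
  · gcongr <;> norm_num
  · intro c hc
    have hf := (SIB.feasible_singleton hc).1 happrox.1
    refine ⟨hf.2, by rw [← SIB.optRadius_singleton hc]; exact happrox.2, ht.trans ?_⟩
    have hR : SIB.ratio (SIB.polytopes P) ≤ 2 := by
      rw [SIB.ratio, div_le_iff₀ hpos]
      exact SIB.diameter_singleton_le hc ⟨_, _, happrox.1⟩
    have hR0 : 0 ≤ SIB.ratio (SIB.polytopes P) := div_nonneg Metric.diam_nonneg hpos.le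
    have hN : (SIB.totalNnz P : ℝ) ≤ n * d := by
      have := SIB.totalNnz_le (P := P) (k := 1) fun i => by simp [hc i]
      rw [one_mul] at this
      exact_mod_cast this
    calc _ ≤ (10 : ℝ) ^ 7 * (2 ^ 2 * ((n : ℝ) * d + n * d) * Real.log n / ε ^ 2) := by gcongr
      _ = 8 * 10 ^ 7 * ((n : ℝ) * d * Real.log n / ε ^ 2) := by ring
      _ ≤ _ := by gcongr; norm_num
  · rintro i j hij rfl
    have hcover : ∀ k : Fin 2, k = i ∨ k = j := by
      intro k
      fin_cases i <;> fin_cases j <;> fin_cases k <;> simp at *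
    have hne : ∀ i, (SIB.polytopes P i).Nonempty := fun i =>
      (Finset.coe_nonempty.2 (hP i)).mono (subset_convexHull ℝ _)
    refine ⟨SIB.setDist_le_of_feasible happrox.1 i j, ?_, ht.trans ?_⟩
    · have h1 := SIB.two_mul_optRadius_le hne hcover
      have h2 := mul_le_mul_of_nonneg_left h1 (by linarith : 0 ≤ 1 + ε)
      linarith [happrox.2]
    · have hlog2 : Real.log (2 : ℕ) ≤ 1 := by
        have := Real.log_two_lt_d9
        push_cast
        linarith
      have hN : (0 : ℝ) ≤ SIB.totalNnz P := Nat.cast_nonneg _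
      have hsum : (SIB.totalNnz P : ℝ) + (2 : ℕ) * d ≤ 2 * ((SIB.totalNnz P : ℝ) + d) := by
        push_cast
        linarith
      calc _ ≤ (10 : ℝ) ^ 7 * (SIB.ratio (SIB.polytopes P) ^ 2 *
            (2 * ((SIB.totalNnz P : ℝ) + d)) * 1 / ε ^ 2) := by gcongr
        _ = 2 * 10 ^ 7 * (SIB.ratio (SIB.polytopes P) ^ 2 * ((SIB.totalNnz P : ℝ) + d) / ε ^ 2) := by
          ring
        _ ≤ _ := by gcongr; norm_num
  · intro a b hab
    have hseg : (fun i => segment ℝ (a i) (b i)) = SIB.polytopes P := by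
      funext i
      rw [SIB.polytopes, hab i, convexHull_pair]
    refine ⟨by rw [hseg]; exact happrox, ht.trans ?_⟩
    have hN : (SIB.totalNnz P : ℝ) ≤ 2 * (n * d) := by
      have := SIB.totalNnz_le (P := P) (k := 2) fun i => by
        rw [← Set.ncard_coe_finset, hab i]
        exact (Set.ncard_insert_le _ _).trans (by simp)
      exact_mod_cast this
    calc _ ≤ (10 : ℝ) ^ 7 * (SIB.ratio (SIB.polytopes P) ^ 2 * (2 * ((n : ℝ) * d) + n * d) *
          Real.log n / ε ^ 2) := by gcongr
      _ = 3 * 10 ^ 7 * (SIB.ratio (SIB.polytopes P) ^ 2 * ((n : ℝ) * d) * Real.log n / ε ^ 2) := by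
        ring
      _ ≤ _ := by gcongr; norm_num
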